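/- Consider a linear descriptor system $E\dot x = Ax+Bu$, $y=Cx$ with $E,A\in\mathbb R^{n\times n}$, $B\in\mathbb R^{n\times m}$, $C\in\mathbb R^{m\times n}$. It is called port-Hamiltonian if there are real matrices $J,R,Q\in\mathbb R^{n\times n}$ and $G,P\in\mathbb R^{n\times m}$ with $$A=(J-R)Q,\quad B=G-P,\quad C=(G+P)^TQ,\quad J^T=-J,\quad Q^TE=E^TQ\ge 0,\quad Q^TRQ=Q^TR^TQ\ge 0,\quad Q^TP=0,$$ where $\ge 0$ means positive semidefinite. A pencil $(E,A)$ is regular if $\det(\alpha E-\beta A)\neq 0$ for some $(\alpha,\beta)\in\mathbb C^2$. In that case there are nonsingular $X,Y$ with $X(sE-A)Y=\operatorname{diag}(sI-\hat J,\ sN-I)$ and $N$ nilpotent, and the index $\operatorname{ind}(E,A)$ is the nilpotency degree of $N$ (and is $0$ if the block $N$ is empty). For a real matrix $M$, let $S_\infty(M)$ and $T_\infty(M)$ denote matrices of full column rank whose columns span the right nullspace $\{v: Mv=0\}$ and the left nullspace $\{v: v^TM=0\}$ of $M$, respectively. Suppose that the system is port-Hamiltonian and completely observable, i.e. $$\operatorname{rank}\begin{bmatrix}\alpha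 E-\beta A\\ C\end{bmatrix}=n\quad\text{for all }(\alpha,\beta)\in\mathbb C^2\setminus\{(0,0)\},$$ and let $r\ge 0$ be an integer. (i) Suppose that $C$ has full row rank $m$. Let $T=T_\infty(E\,S_\infty(C))$ and $S=S_\infty(T_\infty(B)^TE)$ (any choices). Then $T$ and $S$ have $m$ columns and the $m\times m$ matrices $T^TB$ and $CS$ are nonsingular. Put $\mu=\operatorname{rank}(T^TAS)$. There exists $K\in\mathbb R^{m\times m}$ such that $(E+BKC,A)$ is regular, $\operatorname{ind}(E+BKC,A)\le 1$, $\operatorname{rank}(E+BKC)=r$, and the closed-loop system $(E+BKC)\dot x=Ax+Bv$, $y=Cx$ is port-Hamiltonian, if and only if $$n-\mu\le r\le n,$$ and $n-r$ is even whenever $\mu>0$, $\mu$ is even and the matrix $(T^TB)^{-1}(T^TAS)(CS)^{-1}$ is skew-symmetric. (ii) There exist $F,K\in\mathbb R^{m\times m}$ such that $(E+BKC,A+BFC)$ is regular, $\operatorname{ind}(E+BKC,A+BFC)\le 1$, $\operatorname{rank}(E+BKC)=r$, and the closed-loop system $(E+BKC)\dot x=(A+BFC)x+Bv$, $y=Cx$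 is port-Hamiltonian, if and only if $$n-r_b\le r\le n,\qquad r_b=\operatorname{rank}B.$$ -/

import Mathlib

open scoped Matrix

/-- The descriptor system `E x' = A x + B u`, `y = C x` is port-Hamiltonian: there are
`J, R, Q, G, P` with `A = (J - R) Q`, `B = G - P`, `C = (G + P)ᵀ Q`, `Jᵀ = -J`,
`Qᵀ E = Eᵀ Q ≥ 0`, `Qᵀ R Q = Qᵀ Rᵀ Q ≥ 0` and `Qᵀ P = 0`. -/
def IsPortHamiltonian {n m : ℕ} (E A : Matrix (Fin n) (Fin n) ℝ)
    (B : Matrix (Fin n) (Fin m) ℝ) (C : Matrix (Fin m) (Fin n) ℝ) : Prop :=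
  ∃ (J R Q : Matrix (Fin n) (Fin n) ℝ) (G P : Matrix (Fin n) (Fin m) ℝ),
    A = (J - R) * Q ∧ B = G - P ∧ C = (G + P)ᵀ * Q ∧ Jᵀ = -J ∧
    Qᵀ * E = Eᵀ * Q ∧ (Qᵀ * E).PosSemidef ∧
    Qᵀ * R * Q = Qᵀ * Rᵀ * Q ∧ (Qᵀ * R * Q).PosSemidef ∧
    Qᵀ * P = 0

/-- Complete observability: the matrix with block rows `α E - β A` and `C` has rank `n` for all
`(α, β) ∈ ℂ²` other than `(0, 0)`. -/
def IsCompletelyObservable {n m : ℕ} (E A : Matrix (Fin n) (Fin n) ℝ)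
    (C : Matrix (Fin m) (Fin n) ℝ) : Prop :=
  ∀ α β : ℂ, (α, β) ≠ (0, 0) →
    (Matrix.fromRows (α • E.map Complex.ofReal - β • A.map Complex.ofReal)
      (C.map Complex.ofReal)).rank = n

/-- The pencil `(E, A)` is regular: `det (α E - β A) ≠ 0` for some `(α, β) ∈ ℂ²`. -/
def IsRegularPencil {n : ℕ} (E A : Matrix (Fin n) (Fin n) ℝ) : Prop :=
  ∃ α β : ℂ, (α • E.map Complex.ofReal - β • A.map Complex.ofReal).det ≠ 0

/-- The pencil `(E, A)` has index `ν`: there are nonsingular `X`, `Y` such that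
`X (s E - A) Y = diag (s I - J, s N - I)` with `N` nilpotent of nilpotency degree `ν`
(the least `ν` with `N ^ ν = 0`; it is `0` exactly when the block `N` is empty). The two diagonal
blocks have sizes `p` and `q`, and `e` identifies the `n` indices with the `p + q` block indices. -/
def HasPencilIndex {n : ℕ} (E A : Matrix (Fin n) (Fin n) ℝ) (ν : ℕ) : Prop :=
  ∃ (p q : ℕ) (e : Fin n ≃ Fin p ⊕ Fin q) (X Y : Matrix (Fin n) (Fin n) ℝ)
    (J : Matrix (Fin p) (Fin p) ℝ) (N : Matrix (Fin q) (Fin q) ℝ),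
    IsUnit X ∧ IsUnit Y ∧
    X * E * Y = (Matrix.fromBlocks 1 0 0 N).submatrix e e ∧
    X * A * Y = (Matrix.fromBlocks J 0 0 1).submatrix e e ∧
    IsNilpotent N ∧ nilpotencyClass N = ν

/-- The pencil `(E, A)` is regular and its index is at most one. -/
def IsRegularIndexLEOne {n : ℕ} (E A : Matrix (Fin n) (Fin n) ℝ) : Prop :=
  IsRegularPencil E A ∧ ∃ ν ≤ 1, HasPencilIndex E A ν

/-- `S` is a matrix `S_∞(M)`: it has full column rank and its columns span the right nullspace
of `M`. -/
def IsRightNullMatrix {a b k : ℕ} (M : Matrix (Fin a) (Fin b) ℝ)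
    (S : Matrix (Fin b) (Fin k) ℝ) : Prop :=
  LinearIndependent ℝ Sᵀ.row ∧
    Submodule.span ℝ (Set.range Sᵀ.row) = LinearMap.ker M.mulVecLin

/-- `T` is a matrix `T_∞(M)`: it has full column rank and its columns span the left nullspace
`{v | vᵀ M = 0}` of `M`. -/
def IsLeftNullMatrix {a b k : ℕ} (M : Matrix (Fin a) (Fin b) ℝ)
    (T : Matrix (Fin a) (Fin k) ℝ) : Prop :=
  LinearIndependent ℝ Tᵀ.row ∧
    Submodule.span ℝ (Set.range Tᵀ.row) = LinearMap.ker M.vecMulLinear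

/-- `T` is a choice of `T_∞(E S_∞(C))` and `S` is a choice of `S_∞(T_∞(B)ᵀ E)`, formed with some
choices of the inner matrices `S_∞(C)` and `T_∞(B)`. -/
def IsNullPair {n m t s : ℕ} (E : Matrix (Fin n) (Fin n) ℝ)
    (B : Matrix (Fin n) (Fin m) ℝ) (C : Matrix (Fin m) (Fin n) ℝ)
    (T : Matrix (Fin n) (Fin t) ℝ) (S : Matrix (Fin n) (Fin s) ℝ) : Prop :=
  (∃ (p : ℕ) (SC : Matrix (Fin n) (Fin p) ℝ),
    IsRightNullMatrix C SC ∧ IsLeftNullMatrix (E * SC) T) ∧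
  (∃ (q : ℕ) (TB : Matrix (Fin n) (Fin q) ℝ),
    IsLeftNullMatrix B TB ∧ IsRightNullMatrix (TBᵀ * E) S)

/-! Observability at `(0, 1)` makes `Q` invertible, and at `(1, 0)` it gives `ker E ∩ ker C = 0`; no
other point is needed. Multiplying by `Qᵀ` reduces to `E ≥ 0`, `A` dissipative and `B = Cᵀ`
(`IsPortHamiltonian.exists_isUnit`).

If `C` has full row rank, there is a unique `S` with `C S = 1` and `E S = Cᵀ W` for some `W`.
Writing the gain as `X - W`, the new `E` has kernel `S (ker X)`, hence rank `n - dim ker X`. A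
port-Hamiltonian closed loop has symmetric `E`, whose range is the orthogonal complement of its
kernel. Regularity with index at most one says that no nonzero `v ∈ ker E` has `A v ∈ im E`, so it
means that the form `a = Sᵀ A S` is nondegenerate on `ker X` (`isRegularIndexLEOne_feedback_iff`).
Conversely, every subspace is the kernel of some `X ≥ 0`, and such an `X` preserves the structure.

So (i) asks for the dimensions of subspaces on which `a`, with `a x x ≤ 0`, is nondegenerate. They
are all numbers up to `rank a`, only the even ones if `a` is skew
(`exists_isNondegenerateOn_finrank_eq`). In (ii), `F = -1` makes the form definite, so parity and
`A` no longer matter; the lower bound holds because `ker (E + B K C)` meets `ker C` trivially. -/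

/-! ### Nondegenerate subspaces of forms with semidefinite symmetric part. -/

section Selection

variable {V : Type*} [AddCommGroup V] [Module ℝ V]

/-- The bilinear form `a` is nondegenerate on the subspace `U`. -/
def IsNondegenerateOn (a : V →ₗ[ℝ] V →ₗ[ℝ] ℝ) (U : Submodule ℝ V) : Prop :=
  ∀ x ∈ U, (∀ y ∈ U, a y x = 0) → x = 0

theorem skew_of_apply_self_eq_zero {a : V →ₗ[ℝ] V →ₗ[ℝ] ℝ} (ha : ∀ x, a x x ≤ 0) {x : V}
    (hx : a x x = 0) (y : V) : a x y = -a y x := by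
  obtain ⟨b, hb⟩ : ∃ b, b = a x y + a y x := ⟨_, rfl⟩
  have hc := ha y
  have hpos : 0 < 1 - a y y := by linarith
  -- With `t = b / (1 - a y y)` the form takes the value `t * b + t ^ 2 * a y y = t ^ 2`; the
  -- summand 1 keeps the denominator positive even if `a y y = 0`.
  have h := ha (x + (b / (1 - a y y)) • y)
  have e : a (x + (b / (1 - a y y)) • y) (x + (b / (1 - a y y)) • y)
      = (b / (1 - a y y)) ^ 2 := by
    simp only [map_add, map_smul, LinearMap.add_apply, LinearMap.smul_apply, smul_eq_mul, hx]
    have : a y x = b - a x y := by linarith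
    rw [this]
    field_simp
    ring
  rw [e] at h
  have h2 : b / (1 - a y y) = 0 := by nlinarith
  have h3 : b = 0 := by
    rcases div_eq_zero_iff.1 h2 with h | h
    · exact h
    · exact absurd h hpos.ne'
  linarith

variable [FiniteDimensional ℝ V]

theorem finrank_sup_span_singleton_of_notMem {U : Submodule ℝ V} {v : V} (hv : v ∉ U) :
    Module.finrank ℝ (U ⊔ Submodule.span ℝ {v} : Submodule ℝ V) = Module.finrank ℝ U + 1 := by
  have hv0 : v ≠ 0 := fun h => hv (h ▸ U.zero_mem)
  have hd : U ⊓ Submodule.span ℝ {v} = ⊥ := by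
    rw [Submodule.eq_bot_iff]
    rintro x ⟨hxU, hxv⟩
    obtain ⟨c, rfl⟩ := Submodule.mem_span_singleton.1 hxv
    by_contra hc
    have hc0 : c ≠ 0 := fun h => hc (by simp [h])
    exact hv ((U.smul_mem_iff hc0).1 hxU)
  have := Submodule.finrank_sup_add_finrank_inf_eq U (Submodule.span ℝ {v})
  rw [hd, finrank_bot, finrank_span_singleton hv0] at this
  simpa using this

theorem exists_submodule_between_finrank_eq {U P : Submodule ℝ V} (hUP : U ≤ P) {k : ℕ}
    (hk : Module.finrank ℝ U ≤ k) (hkP : k ≤ Module.finrank ℝ P) :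
    ∃ W : Submodule ℝ V, U ≤ W ∧ W ≤ P ∧ Module.finrank ℝ W = k := by
  induction k, hk using Nat.le_induction with
  | base => exact ⟨U, le_rfl, hUP, rfl⟩
  | succ k _ ih =>
    obtain ⟨W, hUW, hWP, hW⟩ := ih (by omega)
    obtain ⟨v, hvP, hvW⟩ : ∃ v ∈ P, v ∉ W := by
      by_contra! h
      have := Submodule.finrank_mono (show P ≤ W from h)
      omega
    refine ⟨W ⊔ Submodule.span ℝ {v}, hUW.trans le_sup_left, sup_le hWP ?_, ?_⟩
    · simpa [Submodule.span_le] using hvP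
    · rw [finrank_sup_span_singleton_of_notMem hvW, hW]

/-- A hyperbolic plane through `z` splits off from a nondegenerate subspace of a skew form. -/
theorem IsNondegenerateOn.exists_finrank_add_two {j : V →ₗ[ℝ] V →ₗ[ℝ] ℝ}
    (hj : ∀ x y, j x y = -j y x) {U : Submodule ℝ V} (hU : IsNondegenerateOn j U)
    {z : V} (hzU : z ∈ U) (hz : z ≠ 0) :
    ∃ W ≤ U, IsNondegenerateOn j W ∧ Module.finrank ℝ W + 2 = Module.finrank ℝ U ∧
      ∀ w ∈ W, j z w = 0 := by
  obtain ⟨y, hyU, hyz⟩ : ∃ y ∈ U, j y z ≠ 0 := by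
    by_contra! h
    exact hz (hU z hzU h)
  have hself : ∀ x, j x x = 0 := fun x => by linarith [hj x x]
  have hzy : j z y ≠ 0 := by rw [hj]; simpa using hyz
  let f : U →ₗ[ℝ] ℝ × ℝ := ((j y).prod (j z)).comp U.subtype
  have hf : ∀ u : U, f u = (j y u, j z u) := fun u => rfl
  have hsurj : Function.Surjective f := by
    rintro ⟨c, d⟩
    refine ⟨(c / j y z) • ⟨z, hzU⟩ + (d / j z y) • ⟨y, hyU⟩, ?_⟩
    simp [hf, hself, hyz, hzy]
  refine ⟨(LinearMap.ker f).map U.subtype, Submodule.map_subtype_le _ _, ?_, ?_, ?_⟩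
  · rintro x hx h
    obtain ⟨⟨x, hxU⟩, hxf, rfl⟩ := hx
    have hxf' : j y x = 0 ∧ j z x = 0 := by simpa [hf] using hxf
    refine hU x hxU fun u hu => ?_
    -- `v` is the component of `u` orthogonal to the plane of `y` and `z`; `x` is orthogonal to that
    -- plane, so `u` and `v` pair equally with it.
    obtain ⟨v, hv⟩ : ∃ v, v = u - (j y u / j y z) • z - (j z u / j z y) • y := ⟨_, rfl⟩
    have hvU : v ∈ U := hv ▸ U.sub_mem (U.sub_mem hu (U.smul_mem _ hzU)) (U.smul_mem _ hyU)
    have h0 := h v ⟨⟨v, hvU⟩, by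
      simp only [SetLike.mem_coe, LinearMap.mem_ker, hf, hv]
      simp [hself, hyz, hzy], rfl⟩
    rw [hv] at h0
    simpa [hxf'.1, hxf'.2] using h0
  · rw [Submodule.finrank_map_subtype_eq, ← LinearMap.finrank_range_add_finrank_ker f,
      LinearMap.range_eq_top.2 hsurj, finrank_top, Module.finrank_prod, Module.finrank_self]
    omega
  · rintro x ⟨⟨x, hxU⟩, hxf, rfl⟩
    have hxf' : j y x = 0 ∧ j z x = 0 := by simpa [hf] using hxf
    exact hxf'.2

/-- Splitting off hyperbolic planes lowers the dimension by two at a time. Evenness is proved in the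
same induction because it turns `k < dim U` into `k ≤ dim U - 2`. -/
theorem IsNondegenerateOn.exists_le_finrank_eq {j : V →ₗ[ℝ] V →ₗ[ℝ] ℝ}
    (hj : ∀ x y, j x y = -j y x) {U : Submodule ℝ V} (hU : IsNondegenerateOn j U) {k : ℕ}
    (hk : Even k) (hkU : k ≤ Module.finrank ℝ U) :
    Even (Module.finrank ℝ U) ∧
      ∃ W ≤ U, IsNondegenerateOn j W ∧ Module.finrank ℝ W = k := by
  induction hd : Module.finrank ℝ U using Nat.strong_induction_on generalizing U k with
  | _ d ih =>
    subst hd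
    by_cases hb : U = ⊥
    · subst hb
      rw [finrank_bot] at hkU ⊢
      exact ⟨by simp, ⊥, le_rfl, hU, by rw [finrank_bot]; omega⟩
    · obtain ⟨z, hzU, hz⟩ := Submodule.exists_mem_ne_zero_of_ne_bot hb
      obtain ⟨W, hWU, hW, hWd, -⟩ := hU.exists_finrank_add_two hj hzU hz
      have hev : Even (Module.finrank ℝ U) := by
        rw [← hWd]
        exact ((ih _ (by omega) hW Even.zero (Nat.zero_le _) rfl).1).add (by decide)
      refine ⟨hev, ?_⟩
      rcases hkU.eq_or_lt with rfl | hlt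
      · exact ⟨U, le_rfl, hU, rfl⟩
      · obtain ⟨-, W', hW'W, hW', hW'd⟩ := ih _ (by omega) hW hk (by
          obtain ⟨a, rfl⟩ := hk
          obtain ⟨b, hb⟩ := hev
          omega) rfl
        exact ⟨W', hW'W.trans hWU, hW', hW'd⟩

theorem IsNondegenerateOn.even_finrank {j : V →ₗ[ℝ] V →ₗ[ℝ] ℝ}
    (hj : ∀ x y, j x y = -j y x) {U : Submodule ℝ V} (hU : IsNondegenerateOn j U) :
    Even (Module.finrank ℝ U) :=
  (hU.exists_le_finrank_eq hj Even.zero (Nat.zero_le _)).1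

/-- A form with negative semidefinite symmetric part is nondegenerate on some subspace of each
dimension up to its rank, where the dimension has to be even if the form is skew. -/
theorem exists_isNondegenerateOn_finrank_eq {a : V →ₗ[ℝ] V →ₗ[ℝ] ℝ} (ha : ∀ x, a x x ≤ 0) {k : ℕ}
    (hk : k + Module.finrank ℝ (LinearMap.ker a.flip) ≤ Module.finrank ℝ V)
    (hskew : (∀ x y, a x y = -a y x) → Even k) :
    ∃ U : Submodule ℝ V, Module.finrank ℝ U = k ∧ IsNondegenerateOn a U := by
  obtain ⟨j, hj⟩ : ∃ j : V →ₗ[ℝ] V →ₗ[ℝ] ℝ, ∀ x y, j x y = a x y - a y x :=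
    ⟨a - a.flip, fun x y => by simp⟩
  have hjs : ∀ x y, j x y = -j y x := fun x y => by rw [hj, hj]; ring
  -- A vector in the radical of `a` on `U` is isotropic, hence in the radical of the skew part `j`.
  -- So nondegeneracy of `j` on `U` implies that of `a`.
  have hja : ∀ {U : Submodule ℝ V} {x : V}, x ∈ U → (∀ y ∈ U, a y x = 0) →
      ∀ y ∈ U, j y x = 0 := fun {U x} hx h y hy => by
    have h1 := skew_of_apply_self_eq_zero ha (h x hx) y
    rw [hj, h1, h y hy]; simp
  have hmem : ∀ {x}, x ∈ LinearMap.ker a.flip ↔ ∀ y, a y x = 0 := fun {x} => by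
    simp [LinearMap.ext_iff]
  have hmemN : ∀ {x}, x ∈ LinearMap.ker j ↔ ∀ y, j x y = 0 := fun {x} => by
    simp [LinearMap.ext_iff]
  obtain ⟨U₀, hU₀⟩ := Submodule.exists_isCompl (LinearMap.ker j)
  have hdecomp : ∀ x, ∃ n ∈ LinearMap.ker j, ∃ u ∈ U₀, n + u = x := fun x =>
    Submodule.mem_sup.1 (by rw [hU₀.sup_eq_top]; trivial)
  have hnd : IsNondegenerateOn j U₀ := by
    intro x hx h
    refine Submodule.disjoint_def.1 hU₀.disjoint x (hmemN.2 fun y => ?_) hx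
    obtain ⟨n, hn, u, hu, rfl⟩ := hdecomp y
    rw [map_add, hjs x n, hmemN.1 hn, hjs, h u hu]; simp
  have hle : LinearMap.ker a.flip ≤ LinearMap.ker j := fun x hx => hmemN.2 fun y => by
    rw [hj, skew_of_apply_self_eq_zero ha (hmem.1 hx x) y, hmem.1 hx y]; simp
  by_cases hkU : Module.finrank ℝ U₀ ≤ k
  -- Large `k`: any `U` between `U₀` and a complement `P` of the radical of `a` works. A radical
  -- vector of `U` lies in `ker j` and is isotropic, hence lies in the radical of `a`, which meets
  -- `P` trivially.
  · obtain ⟨P, hU₀P, hP⟩ := (hU₀.disjoint.mono_left hle).symm.exists_isCompl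
    have hPd := Submodule.finrank_add_eq_of_isCompl hP
    obtain ⟨U, hU₀U, hUP, hUk⟩ := exists_submodule_between_finrank_eq hU₀P hkU (by omega)
    refine ⟨U, hUk, fun x hx h => ?_⟩
    have hjx := hja hx h
    have hxN : x ∈ LinearMap.ker j := by
      obtain ⟨n, hn, u, hu, rfl⟩ := hdecomp x
      have : u = 0 := hnd u hu fun y hy => by
        have := hjx y (hU₀U hy)
        rw [map_add, hjs y n, hmemN.1 hn] at this
        simpa using this
      simpa [this] using hn
    refine Submodule.disjoint_def.1 hP.disjoint x (hUP hx) (hmem.2 fun y => ?_)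
    have h1 := skew_of_apply_self_eq_zero ha (h x hx) y
    have h2 := hmemN.1 hxN y
    rw [hj] at h2
    linarith
  rcases Nat.even_or_odd k with hev | hodd
  · obtain ⟨-, W, -, hW, hWk⟩ := hnd.exists_le_finrank_eq hjs hev (by omega)
    exact ⟨W, hWk, fun x hx h => hW x hx (hja hx h)⟩
  -- Odd `k`: take a `j`-nondegenerate `W` of dimension `k - 1`, orthogonal to an anisotropic `z`,
  -- and adjoin `z`. Restricting to the orthogonal complement of `v` costs two dimensions, which
  -- fits since `k` is odd and less than the even `dim U₀`.
  · obtain ⟨z, hz⟩ : ∃ z, a z z ≠ 0 := by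
      by_contra! h
      exact Nat.not_even_iff_odd.2 hodd (hskew fun x y => skew_of_apply_self_eq_zero ha (h x) y)
    obtain ⟨n, hn, u, hu, hnu⟩ := hdecomp z
    have hzu : ∀ y, j z y = j u y := fun y => by rw [← hnu]; simp [hmemN.1 hn]
    obtain ⟨v, hv, hv0, hvu⟩ : ∃ v ∈ U₀, v ≠ 0 ∧ ∀ y, j v y = 0 → j z y = 0 := by
      by_cases hu0 : u = 0
      · have hb : U₀ ≠ ⊥ := by
          rintro rfl
          rw [finrank_bot] at hkU
          omega
        obtain ⟨v, hv, hv0⟩ := Submodule.exists_mem_ne_zero_of_ne_bot hb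
        exact ⟨v, hv, hv0, fun y _ => by rw [hzu, hu0]; simp⟩
      · exact ⟨u, hu, hu0, fun y h => by rw [hzu, h]⟩
    obtain ⟨W₀, -, hW₀, hW₀d, hW₀v⟩ := hnd.exists_finrank_add_two hjs hv hv0
    have hevU := hnd.even_finrank hjs
    obtain ⟨-, W, hWW₀, hW, hWk⟩ := hW₀.exists_le_finrank_eq hjs (k := k - 1)
      (by obtain ⟨c, rfl⟩ := hodd; exact ⟨c, by omega⟩)
      (by obtain ⟨c, rfl⟩ := hodd; obtain ⟨d, hd⟩ := hevU; omega)
    have hWz : ∀ w ∈ W, j z w = 0 := fun w hw => hvu w (hW₀v w (hWW₀ hw))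
    have hzW : z ∉ W := fun h => hz <| by
      rw [hW z h fun y hy => by rw [hjs, hWz y hy, neg_zero]]; simp
    refine ⟨W ⊔ Submodule.span ℝ {z}, ?_, fun x hx h => ?_⟩
    · rw [finrank_sup_span_singleton_of_notMem hzW, hWk]
      obtain ⟨c, rfl⟩ := hodd
      omega
    · have hjx := hja hx h
      have hxx := h x hx
      obtain ⟨w, hw, t, ht, rfl⟩ := Submodule.mem_sup.1 hx
      obtain ⟨c, rfl⟩ := Submodule.mem_span_singleton.1 ht
      have hw0 : w = 0 := hW w hw fun y hy => by
        have := hjx y (Submodule.mem_sup_left hy)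
        rw [map_add, map_smul, hjs y z, hWz y hy] at this
        simpa using this
      subst hw0
      have : c = 0 := by simpa [hz] using hxx
      simp [this]

end Selection

/-! ### Kernel criterion for a regular pencil of index at most one. -/

section Index

open Matrix

theorem HasPencilIndex.eq_zero_of_mulVec_eq {n ν : ℕ} {E A : Matrix (Fin n) (Fin n) ℝ}
    (h : HasPencilIndex E A ν) (hν : ν ≤ 1) {v w : Fin n → ℝ} (hv : E *ᵥ v = 0)
    (hw : A *ᵥ v = E *ᵥ w) : v = 0 := by
  obtain ⟨p, q, e, X, Y, J, N, hX, hY, hE, hA, hN, hNν⟩ := h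
  have hN0 : N = 0 := by
    have h1 : N ^ 1 = 0 := pow_eq_zero_of_le (hNν.trans_le hν) (pow_nilpotencyClass hN)
    simpa using h1
  subst hN0
  have hYdet := (Matrix.isUnit_iff_isUnit_det _).1 hY
  have hYi : ∀ u, Y *ᵥ (Y⁻¹ *ᵥ u) = u := fun u => by
    rw [mulVec_mulVec, mul_nonsing_inv _ hYdet, one_mulVec]
  have key : ∀ (M : Matrix (Fin n) (Fin n) ℝ) (D : Matrix (Fin p ⊕ Fin q) (Fin p ⊕ Fin q) ℝ),
      X * M * Y = D.submatrix e e → ∀ u, (X *ᵥ (M *ᵥ u)) ∘ e.symm = D *ᵥ ((Y⁻¹ *ᵥ u) ∘ e.symm) := by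
    intro M D h u
    conv_lhs => rw [← hYi u, mulVec_mulVec, mulVec_mulVec, h, Matrix.submatrix_mulVec_equiv]
    ext i; simp
  have h1 := key E _ hE v
  have h2 := key A _ hA v
  have h3 := key E _ hE w
  rw [hw, h3] at h2
  rw [hv, mulVec_zero] at h1
  obtain ⟨z, hz⟩ : ∃ z, z = (Y⁻¹ *ᵥ v) ∘ e.symm := ⟨_, rfl⟩
  rw [← hz] at h1 h2
  have hz0 : z = 0 := by
    funext i
    rcases i with i | i
    · have := congrFun h1 (Sum.inl i)
      simpa [fromBlocks_mulVec] using this.symm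
    · have := congrFun h2 (Sum.inr i)
      simpa [fromBlocks_mulVec] using this.symm
  have : Y⁻¹ *ᵥ v = 0 := by
    funext i
    have := congrFun hz0 (e i)
    rw [hz] at this
    simpa using this
  rw [← hYi v, this, mulVec_zero]

/-- The normal form has determinant `± det (t I - J)` at `(t, 1)`, which is nonzero for any real `t`
off the spectrum of `J`. -/
theorem isRegularPencil_of_forall {n : ℕ} {E A : Matrix (Fin n) (Fin n) ℝ} {p q : ℕ}
    (e : Fin n ≃ Fin p ⊕ Fin q) {X Y : Matrix (Fin n) (Fin n) ℝ} {J : Matrix (Fin p) (Fin p) ℝ}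
    (hE : X * E * Y = (fromBlocks 1 0 0 0).submatrix e e)
    (hA : X * A * Y = (fromBlocks J 0 0 1).submatrix e e) : IsRegularPencil E A := by
  obtain ⟨t, ht⟩ : ∃ t : ℝ, (t • (1 : Matrix (Fin p) (Fin p) ℝ) - J).det ≠ 0 := by
    obtain ⟨t, ht⟩ := (J.charpoly.rootSet_finite ℝ).infinite_compl.nonempty
    refine ⟨t, fun h => ht ?_⟩
    rw [Polynomial.mem_rootSet]
    refine ⟨J.charpoly_monic.ne_zero, ?_⟩
    rw [Polynomial.coe_aeval_eq_eval, Matrix.eval_charpoly, ← h]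
    congr 2
    ext i j; simp [Matrix.scalar_apply, Matrix.diagonal_apply, Matrix.one_apply]
  refine ⟨t, 1, fun h => ?_⟩
  have h0 : (t • E - A).det = 0 := by
    have e1 : ((t : ℂ) • E.map Complex.ofReal - (1 : ℂ) • A.map Complex.ofReal)
        = (Complex.ofRealHom.mapMatrix (t • E - A)) := by
      ext i j; simp
    rw [e1, ← RingHom.map_det] at h
    simpa using h
  have h1 : X * (t • E - A) * Y
      = (fromBlocks (t • 1 - J) 0 0 (-1)).submatrix e e := by
    rw [Matrix.mul_sub, Matrix.sub_mul, Matrix.mul_smul, Matrix.smul_mul, hE, hA]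
    ext i j
    rcases h1 : e i with a | a <;> rcases h2 : e j with b | b <;> simp [h1, h2]
  have h2 := congrArg Matrix.det h1
  rw [det_mul, det_mul, h0, det_submatrix_equiv_self, det_fromBlocks_zero₂₁] at h2
  simp [det_neg, ht] at h2

theorem exists_matrix_forall_mem_iff {n k : ℕ} (L : Submodule ℝ (Fin n → ℝ))
    (hk : Module.finrank ℝ L = k) :
    ∃ M : Matrix (Fin n) (Fin k) ℝ, (∀ x, M *ᵥ x = 0 → x = 0) ∧
      ∀ v, v ∈ L ↔ ∃ x, M *ᵥ x = v := by
  let b := Module.finBasisOfFinrankEq ℝ L hk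
  have hM : ∀ x, LinearMap.toMatrix' (L.subtype ∘ₗ b.equivFun.symm.toLinearMap) *ᵥ x
      = (b.equivFun.symm x : Fin n → ℝ) := fun x => by
    rw [← Matrix.toLin'_apply, Matrix.toLin'_toMatrix']; rfl
  refine ⟨LinearMap.toMatrix' (L.subtype ∘ₗ b.equivFun.symm.toLinearMap), fun x hx => ?_,
    fun v => ⟨fun hv => ?_, ?_⟩⟩
  · rw [hM] at hx
    exact b.equivFun.symm.map_eq_zero_iff.1 (Subtype.ext hx)
  · exact ⟨b.equivFun ⟨v, hv⟩, by rw [hM]; simp⟩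
  · rintro ⟨x, rfl⟩
    rw [hM]
    exact Submodule.coe_mem _

theorem finrank_ker_mulVecLin_add_rank {a b : ℕ} (M : Matrix (Fin a) (Fin b) ℝ) :
    Module.finrank ℝ (LinearMap.ker M.mulVecLin) + M.rank = b := by
  have := LinearMap.finrank_range_add_finrank_ker M.mulVecLin
  rw [Module.finrank_fin_fun] at this
  rw [Matrix.rank]
  omega

theorem isUnit_of_mulVec_eq_zero {n : ℕ} {M : Matrix (Fin n) (Fin n) ℝ}
    (h : ∀ x, M *ᵥ x = 0 → x = 0) : IsUnit M := by
  rw [← Matrix.mulVec_injective_iff_isUnit]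
  intro x y hxy
  exact sub_eq_zero.1 (h _ (by rw [mulVec_sub]; exact sub_eq_zero.2 hxy))

/-- The hypothesis says that `L = A⁻¹(im E)` meets `K = ker E` trivially. Since `dim L ≥ rank E`,
the space is `L ⊕ K`, and bases of `L` and `K` put the pencil in normal form with `N = 0`. -/
theorem isRegularIndexLEOne_of_forall {n : ℕ} {E A : Matrix (Fin n) (Fin n) ℝ}
    (h : ∀ v w, E *ᵥ v = 0 → A *ᵥ v = E *ᵥ w → v = 0) : IsRegularIndexLEOne E A := by
  let K := LinearMap.ker E.mulVecLin
  let L := (LinearMap.range E.mulVecLin).comap A.mulVecLin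
  have hLmem : ∀ v, v ∈ L ↔ ∃ w, E *ᵥ w = A *ᵥ v := fun v => Iff.rfl
  have hKmem : ∀ v, v ∈ K ↔ E *ᵥ v = 0 := fun v => Iff.rfl
  have hdisj : Disjoint L K := Submodule.disjoint_def.2 fun v hL hK => by
    obtain ⟨w, hw⟩ := (hLmem v).1 hL
    exact h v w hK hw.symm
  have hdim : n ≤ Module.finrank ℝ L + Module.finrank ℝ K := by
    have h1 := LinearMap.finrank_range_add_finrank_ker
      ((LinearMap.range E.mulVecLin).mkQ ∘ₗ A.mulVecLin)
    have h2 : LinearMap.ker ((LinearMap.range E.mulVecLin).mkQ ∘ₗ A.mulVecLin) = L := by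
      rw [LinearMap.ker_comp, Submodule.ker_mkQ]
    have h3 := Submodule.finrank_le
      (LinearMap.range ((LinearMap.range E.mulVecLin).mkQ ∘ₗ A.mulVecLin))
    have h4 := Submodule.finrank_quotient_add_finrank (LinearMap.range E.mulVecLin)
    have h5 := LinearMap.finrank_range_add_finrank_ker E.mulVecLin
    rw [h2, Module.finrank_fin_fun] at h1
    rw [Module.finrank_fin_fun] at h4 h5
    change _ + Module.finrank ℝ K = _ at h5
    omega
  have hLK : L ⊔ K = ⊤ := by
    apply Submodule.eq_top_of_finrank_eq
    have h1 := Submodule.finrank_sup_add_finrank_inf_eq L K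
    have h2 := Submodule.finrank_le (L ⊔ K)
    rw [hdisj.eq_bot, finrank_bot] at h1
    rw [Module.finrank_fin_fun] at h2 ⊢
    omega
  have hn : Module.finrank ℝ L + Module.finrank ℝ K = n := by
    have h1 := Submodule.finrank_sup_add_finrank_inf_eq L K
    rw [hdisj.eq_bot, finrank_bot, hLK, finrank_top, Module.finrank_fin_fun] at h1
    omega
  obtain ⟨Y₁, hY₁, hL⟩ := exists_matrix_forall_mem_iff L rfl
  obtain ⟨Y₂, hY₂, hK⟩ := exists_matrix_forall_mem_iff K rfl
  have hEY₂ : E * Y₂ = 0 := by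
    refine Matrix.ext_of_mulVec_single fun i => ?_
    rw [← mulVec_mulVec, zero_mulVec]
    exact (hKmem _).1 ((hK _).2 ⟨_, rfl⟩)
  -- `E` kills the `K`-component of a preimage, so the preimage can be taken in `L`.
  have hJ : ∀ i, ∃ x, E *ᵥ (Y₁ *ᵥ x) = A *ᵥ (Y₁ *ᵥ Pi.single i 1) := fun i => by
    obtain ⟨w, hw⟩ := (hLmem _).1 ((hL _).2 ⟨Pi.single i 1, rfl⟩)
    obtain ⟨l, hl, k, hk, rfl⟩ := Submodule.mem_sup.1 (show w ∈ L ⊔ K by rw [hLK]; trivial)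
    obtain ⟨x, rfl⟩ := (hL l).1 hl
    exact ⟨x, by rw [← hw, mulVec_add, (hKmem k).1 hk, add_zero]⟩
  choose c hc using hJ
  obtain ⟨J, hJ⟩ : ∃ J : Matrix (Fin (Module.finrank ℝ L)) (Fin (Module.finrank ℝ L)) ℝ,
      A * Y₁ = E * Y₁ * J := by
    refine ⟨(Matrix.of c)ᵀ, Matrix.ext_of_mulVec_single fun i => ?_⟩
    rw [← mulVec_mulVec, ← hc, ← mulVec_mulVec, ← mulVec_mulVec, mulVec_single_one]
    rfl
  let e : Fin n ≃ Fin (Module.finrank ℝ L) ⊕ Fin (Module.finrank ℝ K) :=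
    (finCongr hn.symm).trans finSumFinEquiv.symm
  have hunit : ∀ M : Matrix (Fin n) (Fin (Module.finrank ℝ L) ⊕ Fin (Module.finrank ℝ K)) ℝ,
      (∀ x, M *ᵥ x = 0 → x = 0) → IsUnit (M.submatrix id e) := fun M hM => by
    refine isUnit_of_mulVec_eq_zero fun x hx => ?_
    have h1 := hM (x ∘ e.symm) (by
      rw [← hx, Matrix.submatrix_mulVec_equiv]; rfl)
    funext i
    simpa using congrFun h1 (e i)
  have hY : IsUnit ((fromCols Y₁ Y₂).submatrix id e) := hunit _ fun x hx => by
    rw [fromCols_mulVec] at hx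
    have h1 : Y₁ *ᵥ (x ∘ Sum.inl) = 0 := by
      refine Submodule.disjoint_def.1 hdisj _ ((hL _).2 ⟨_, rfl⟩) ?_
      rw [eq_neg_of_add_eq_zero_left hx]
      exact K.neg_mem ((hK _).2 ⟨_, rfl⟩)
    rw [h1, zero_add] at hx
    funext i
    rcases i with i | i
    · exact congrFun (hY₁ _ h1) i
    · exact congrFun (hY₂ _ hx) i
  have hZ : IsUnit ((fromCols (E * Y₁) (A * Y₂)).submatrix id e) := hunit _ fun x hx => by
    rw [fromCols_mulVec, ← mulVec_mulVec, ← mulVec_mulVec] at hx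
    have h2 : Y₂ *ᵥ (x ∘ Sum.inr) = 0 := by
      refine h _ (-(Y₁ *ᵥ (x ∘ Sum.inl))) ((hK _).2 ⟨_, rfl⟩) ?_
      rw [mulVec_neg]
      exact eq_neg_of_add_eq_zero_right hx
    rw [h2, mulVec_zero, add_zero] at hx
    have h1 : Y₁ *ᵥ (x ∘ Sum.inl) = 0 :=
      Submodule.disjoint_def.1 hdisj _ ((hL _).2 ⟨_, rfl⟩) hx
    funext i
    rcases i with i | i
    · exact congrFun (hY₁ _ h1) i
    · exact congrFun (hY₂ _ h2) i
  have hZdet := (Matrix.isUnit_iff_isUnit_det _).1 hZ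
  have key : ∀ (M : Matrix (Fin n) (Fin n) ℝ) (D : Matrix (Fin (Module.finrank ℝ L) ⊕ Fin (Module.finrank ℝ K))
        (Fin (Module.finrank ℝ L) ⊕ Fin (Module.finrank ℝ K)) ℝ),
      M * fromCols Y₁ Y₂ = fromCols (E * Y₁) (A * Y₂) * D →
      ((fromCols (E * Y₁) (A * Y₂)).submatrix id e)⁻¹ * M * (fromCols Y₁ Y₂).submatrix id e
        = D.submatrix e e := fun M D hMD => by
    have h1 : M * (fromCols Y₁ Y₂).submatrix id e
        = (fromCols (E * Y₁) (A * Y₂)).submatrix id e * D.submatrix e e := by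
      rw [Matrix.submatrix_mul_equiv, ← hMD]
      rfl
    rw [Matrix.mul_assoc, h1, ← Matrix.mul_assoc, nonsing_inv_mul _ hZdet, Matrix.one_mul]
  have hE := key E (fromBlocks 1 0 0 0) (by
    rw [fromCols_mul_fromBlocks, mul_fromCols, hEY₂]; simp)
  have hA := key A (fromBlocks J 0 0 1) (by
    rw [fromCols_mul_fromBlocks, mul_fromCols, hJ]; simp)
  refine ⟨isRegularPencil_of_forall e hE hA, nilpotencyClass (0 : Matrix (Fin (Module.finrank ℝ K))
    (Fin (Module.finrank ℝ K)) ℝ), ?_, _, _, e, _, _, J, 0, ?_, hY, hE, hA, IsNilpotent.zero, rfl⟩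
  -- The class of the zero block is 1, or 0 if `E` is injective; the bound covers both.
  · exact Nat.sInf_le (by simp)
  · exact (Matrix.isUnit_nonsing_inv_iff).2 hZ

theorem isRegularIndexLEOne_iff {n : ℕ} {E A : Matrix (Fin n) (Fin n) ℝ} :
    IsRegularIndexLEOne E A ↔ ∀ v w, E *ᵥ v = 0 → A *ᵥ v = E *ᵥ w → v = 0 :=
  ⟨fun ⟨_, _, hν, h⟩ _ _ hv hw => h.eq_zero_of_mulVec_eq hν hv hw, isRegularIndexLEOne_of_forall⟩

end Index

/-! ### Null spaces, their bases, and factorizations. -/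

section NullMatrices

open Matrix

theorem exists_transpose_mulVec_eq {a b : ℕ} {C : Matrix (Fin a) (Fin b) ℝ} {w : Fin b → ℝ}
    (h : ∀ v, C *ᵥ v = 0 → w ⬝ᵥ v = 0) : ∃ y, Cᵀ *ᵥ y = w := by
  let f : Module.Dual ℝ (Fin b → ℝ) := dotProductBilin ℝ ℝ w
  have hf : f ∈ (LinearMap.ker C.mulVecLin).dualAnnihilator := by
    rw [Submodule.mem_dualAnnihilator]
    exact fun v hv => h v hv
  rw [← LinearMap.range_dualMap_eq_dualAnnihilator_ker] at hf
  obtain ⟨g, hg⟩ := hf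
  refine ⟨fun i => g (Pi.single i 1), ?_⟩
  have hgv : ∀ v, g v = (fun i => g (Pi.single i 1)) ⬝ᵥ v := fun v => by
    conv_lhs => rw [pi_eq_sum_univ' v]
    simp [dotProduct, mul_comm]
  refine dotProduct_eq _ _ fun v => ?_
  have := LinearMap.congr_fun hg v
  rw [LinearMap.dualMap_apply, hgv] at this
  rw [mulVec_transpose, ← dotProduct_mulVec]
  exact this

theorem exists_eq_mul_of_forall {a b c : ℕ} {B : Matrix (Fin a) (Fin b) ℝ}
    {M : Matrix (Fin a) (Fin c) ℝ} (h : ∀ x, ∃ y, B *ᵥ y = M *ᵥ x) :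
    ∃ W : Matrix (Fin b) (Fin c) ℝ, M = B * W := by
  choose f hf using fun i => h (Pi.single i 1)
  refine ⟨(Matrix.of f)ᵀ, Matrix.ext_of_mulVec_single fun i => ?_⟩
  rw [← hf, ← mulVec_mulVec, mulVec_single_one]
  rfl

theorem isRightNullMatrix_iff {a b k : ℕ} {M : Matrix (Fin a) (Fin b) ℝ}
    {S : Matrix (Fin b) (Fin k) ℝ} :
    IsRightNullMatrix M S ↔
      (∀ x, S *ᵥ x = 0 → x = 0) ∧ ∀ v, (∃ x, S *ᵥ x = v) ↔ M *ᵥ v = 0 := by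
  have h1 : LinearIndependent ℝ Sᵀ.row ↔ ∀ x, S *ᵥ x = 0 → x = 0 := by
    rw [show Sᵀ.row = S.col from rfl, ← Matrix.mulVec_injective_iff]
    exact injective_iff_map_eq_zero S.mulVecLin
  rw [IsRightNullMatrix, h1, show Sᵀ.row = S.col from rfl, ← Matrix.range_mulVecLin,
    SetLike.ext_iff]
  rfl

theorem isLeftNullMatrix_iff {a b k : ℕ} {M : Matrix (Fin a) (Fin b) ℝ}
    {T : Matrix (Fin a) (Fin k) ℝ} : IsLeftNullMatrix M T ↔ IsRightNullMatrix Mᵀ T := by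
  have : LinearMap.ker M.vecMulLinear = LinearMap.ker Mᵀ.mulVecLin := by
    ext v; simp
  rw [IsLeftNullMatrix, IsRightNullMatrix, this]

theorem exists_isRightNullMatrix {a b : ℕ} (M : Matrix (Fin a) (Fin b) ℝ) :
    ∃ (k : ℕ) (S : Matrix (Fin b) (Fin k) ℝ), IsRightNullMatrix M S := by
  obtain ⟨S, hS, h⟩ := exists_matrix_forall_mem_iff (LinearMap.ker M.mulVecLin) rfl
  exact ⟨_, S, isRightNullMatrix_iff.2 ⟨hS, fun v => (h v).symm⟩⟩

/-- The column space is cut out by a basis of the left nullspace. -/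
theorem IsRightNullMatrix.transpose_mulVec_eq_zero_iff {a b k : ℕ} {M : Matrix (Fin a) (Fin b) ℝ}
    {S : Matrix (Fin b) (Fin k) ℝ} (h : IsRightNullMatrix M S) (v : Fin b → ℝ) :
    Sᵀ *ᵥ v = 0 ↔ ∃ y, Mᵀ *ᵥ y = v := by
  obtain ⟨-, h⟩ := isRightNullMatrix_iff.1 h
  constructor
  · refine fun hv => exists_transpose_mulVec_eq fun u hu => ?_
    obtain ⟨x, rfl⟩ := (h u).2 hu
    rw [dotProduct_mulVec, ← mulVec_transpose, hv, zero_dotProduct]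
  · rintro ⟨y, rfl⟩
    refine dotProduct_eq_zero _ fun x => ?_
    rw [mulVec_transpose, ← dotProduct_mulVec, mulVec_transpose, ← dotProduct_mulVec,
      (h _).1 ⟨x, rfl⟩, dotProduct_zero]

/-- Orthogonality to `E (ker C)` means `Eᵀ v ∈ im Cᵀ`, and orthogonality of `E v` to the left
nullspace of `B` means `E v ∈ im B`. This removes the inner choices of bases. -/
theorem isNullPair_iff {n m t s : ℕ} {E : Matrix (Fin n) (Fin n) ℝ}
    {B : Matrix (Fin n) (Fin m) ℝ} {C : Matrix (Fin m) (Fin n) ℝ}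
    {T : Matrix (Fin n) (Fin t) ℝ} {S : Matrix (Fin n) (Fin s) ℝ} :
    IsNullPair E B C T S ↔
      ((∀ x, T *ᵥ x = 0 → x = 0) ∧ ∀ v, (∃ x, T *ᵥ x = v) ↔ ∃ y, Cᵀ *ᵥ y = Eᵀ *ᵥ v) ∧
      ((∀ x, S *ᵥ x = 0 → x = 0) ∧ ∀ v, (∃ x, S *ᵥ x = v) ↔ ∃ y, B *ᵥ y = E *ᵥ v) := by
  have hT : ∀ {p : ℕ} {SC : Matrix (Fin n) (Fin p) ℝ}, IsRightNullMatrix C SC →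
      (IsLeftNullMatrix (E * SC) T ↔
        (∀ x, T *ᵥ x = 0 → x = 0) ∧ ∀ v, (∃ x, T *ᵥ x = v) ↔ ∃ y, Cᵀ *ᵥ y = Eᵀ *ᵥ v) := by
    intro p SC h
    rw [isLeftNullMatrix_iff, isRightNullMatrix_iff]
    simp_rw [transpose_mul, ← mulVec_mulVec, h.transpose_mulVec_eq_zero_iff]
  have hS : ∀ {p : ℕ} {TB : Matrix (Fin n) (Fin p) ℝ}, IsLeftNullMatrix B TB →
      (IsRightNullMatrix (TBᵀ * E) S ↔
        (∀ x, S *ᵥ x = 0 → x = 0) ∧ ∀ v, (∃ x, S *ᵥ x = v) ↔ ∃ y, B *ᵥ y = E *ᵥ v) := by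
    intro p TB h
    rw [isLeftNullMatrix_iff] at h
    rw [isRightNullMatrix_iff]
    simp_rw [← mulVec_mulVec, h.transpose_mulVec_eq_zero_iff, transpose_transpose]
  constructor
  · rintro ⟨⟨p, SC, h1, h2⟩, ⟨q, TB, h3, h4⟩⟩
    exact ⟨(hT h1).1 h2, (hS h3).1 h4⟩
  · rintro ⟨h1, h2⟩
    obtain ⟨p, SC, h3⟩ := exists_isRightNullMatrix C
    obtain ⟨q, TB, h4⟩ := exists_isRightNullMatrix Bᵀ
    rw [← isLeftNullMatrix_iff] at h4
    exact ⟨⟨p, SC, h3, (hT h3).2 h1⟩, ⟨q, TB, h4, (hS h4).2 h2⟩⟩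

theorem exists_posSemidef_ker_eq {m : ℕ} (U : Submodule ℝ (Fin m → ℝ)) :
    ∃ X : Matrix (Fin m) (Fin m) ℝ, X.PosSemidef ∧ LinearMap.ker X.mulVecLin = U := by
  obtain ⟨L, hL⟩ := Submodule.exists_isCompl U
  -- `f` is a projection along `U`; then `fᵀ f` has the same kernel.
  obtain ⟨f, hf⟩ : ∃ f : (Fin m → ℝ) →ₗ[ℝ] (Fin m → ℝ), LinearMap.ker f = U :=
    ⟨L.subtype ∘ₗ Submodule.projectionOnto L U hL.symm, by
      rw [LinearMap.ker_comp_of_ker_eq_bot _ (Submodule.ker_subtype _),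
        Submodule.ker_projectionOnto]⟩
  refine ⟨(LinearMap.toMatrix' f)ᴴ * LinearMap.toMatrix' f,
    Matrix.posSemidef_conjTranspose_mul_self _, ?_⟩
  rw [Matrix.ker_mulVecLin_conjTranspose_mul_self, ← Matrix.toLin'_apply', Matrix.toLin'_toMatrix',
    hf]

/-- Every matrix factors through one of full row rank with the same nullspace. -/
theorem exists_fullRowRank_factor {m n : ℕ} (C : Matrix (Fin m) (Fin n) ℝ) :
    ∃ (D : Matrix (Fin C.rank) (Fin n) ℝ) (M : Matrix (Fin C.rank) (Fin m) ℝ),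
      D.rank = C.rank ∧ D = M * C ∧ ∀ v, D *ᵥ v = 0 → C *ᵥ v = 0 := by
  obtain ⟨D, hD, h⟩ := exists_matrix_forall_mem_iff (LinearMap.range Cᵀ.mulVecLin)
    (k := C.rank) (by rw [← Matrix.rank_transpose]; rfl)
  obtain ⟨W, hW⟩ := exists_eq_mul_of_forall (B := Cᵀ) (M := D) fun x => (h _).2 ⟨x, rfl⟩
  obtain ⟨Y, hY⟩ := exists_eq_mul_of_forall (B := D) (M := Cᵀ) fun x => (h _).1 ⟨x, rfl⟩
  refine ⟨Dᵀ, Wᵀ, ?_, ?_, fun v hv => ?_⟩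
  · have h1 := finrank_ker_mulVecLin_add_rank D
    rw [LinearMap.ker_eq_bot'.2 hD, finrank_bot] at h1
    rw [Matrix.rank_transpose]
    omega
  · rw [hW, transpose_mul, transpose_transpose]
  · rw [← transpose_transpose C, hY, transpose_mul, ← mulVec_mulVec, hv, mulVec_zero]

end NullMatrices

/-! ### Reduction of port-Hamiltonian systems to dissipative form. -/

section PortHamiltonian

open Matrix

theorem mulVec_eq_zero_of_rank_eq {a b n : ℕ} {M : Matrix (Fin a ⊕ Fin b) (Fin n) ℂ}
    (h : M.rank = n) {v : Fin n → ℂ} (hv : M *ᵥ v = 0) : v = 0 := by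
  have h1 := LinearMap.finrank_range_add_finrank_ker M.mulVecLin
  rw [Module.finrank_fin_fun] at h1
  rw [Matrix.rank] at h
  have h2 : LinearMap.ker M.mulVecLin = ⊥ := Submodule.finrank_eq_zero.1 (by omega)
  exact LinearMap.ker_eq_bot'.1 h2 v hv

theorem IsCompletelyObservable.eq_zero {n m : ℕ} {E A : Matrix (Fin n) (Fin n) ℝ}
    {C : Matrix (Fin m) (Fin n) ℝ} (h : IsCompletelyObservable E A C) {a b : ℝ}
    (hab : a ≠ 0 ∨ b ≠ 0) {v : Fin n → ℝ} (hv : (a • E - b • A) *ᵥ v = 0) (hC : C *ᵥ v = 0) :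
    v = 0 := by
  have key : ∀ {k : ℕ} (M : Matrix (Fin k) (Fin n) ℝ), M *ᵥ v = 0 →
      M.map Complex.ofReal *ᵥ (Complex.ofReal ∘ v) = 0 := fun M hM => by
    funext i
    have := RingHom.map_mulVec Complex.ofRealHom M v i
    rw [hM] at this
    exact this.symm.trans (by simp)
  have h1 := mulVec_eq_zero_of_rank_eq (h a b (by simpa [Prod.ext_iff, imp_iff_not_or] using hab))
    (v := Complex.ofReal ∘ v) (by
      rw [fromRows_mulVec, key C hC]
      have : (a : ℂ) • E.map Complex.ofReal - (b : ℂ) • A.map Complex.ofReal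
          = (a • E - b • A).map Complex.ofReal := by
        ext i j; simp
      rw [this, key _ hv]
      ext i; rcases i with i | i <;> rfl)
  funext i
  simpa using congrFun h1 i

theorem IsPortHamiltonian.exists_transpose_mul_eq {n m : ℕ} {E A : Matrix (Fin n) (Fin n) ℝ}
    {B : Matrix (Fin n) (Fin m) ℝ} {C : Matrix (Fin m) (Fin n) ℝ}
    (h : IsPortHamiltonian E A B C) :
    ∃ Q : Matrix (Fin n) (Fin n) ℝ, Qᵀ * B = Cᵀ ∧ (Qᵀ * E).PosSemidef ∧
      (∀ v, v ⬝ᵥ (Qᵀ * A) *ᵥ v ≤ 0) ∧ ∀ v, Q *ᵥ v = 0 → A *ᵥ v = 0 ∧ C *ᵥ v = 0 := by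
  obtain ⟨J, R, Q, G, P, rfl, rfl, rfl, hJ, -, hQE, -, hR, hP⟩ := h
  refine ⟨Q, ?_, hQE, fun v => ?_, fun v hv => ?_⟩
  · rw [Matrix.mul_sub, hP, transpose_mul, transpose_transpose, Matrix.mul_add, hP, sub_zero,
      add_zero]
  · have h1 : v ⬝ᵥ (Qᵀ * (J * Q)) *ᵥ v = 0 := by
      have h2 : v ⬝ᵥ (Qᵀ * (J * Q)) *ᵥ v = v ⬝ᵥ (Qᵀ * (J * Q))ᵀ *ᵥ v := by
        rw [mulVec_transpose, dotProduct_mulVec, dotProduct_comm]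
      rw [show (Qᵀ * (J * Q))ᵀ = -(Qᵀ * (J * Q)) by
        simp [transpose_mul, hJ, Matrix.mul_assoc], neg_mulVec, dotProduct_neg] at h2
      linarith
    have h3 := hR.dotProduct_mulVec_nonneg v
    rw [star_trivial, Matrix.mul_assoc] at h3
    rw [Matrix.sub_mul, Matrix.mul_sub, sub_mulVec, dotProduct_sub, h1]
    linarith
  · simp only [← mulVec_mulVec, hv, mulVec_zero, and_self]

/-- Take `J` and `-R` to be the skew and symmetric parts of `A Q⁻¹`, with `G = B` and `P = 0`. -/
theorem isPortHamiltonian_of_transpose_mul {n m : ℕ} {E A Q : Matrix (Fin n) (Fin n) ℝ}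
    {B : Matrix (Fin n) (Fin m) ℝ} {C : Matrix (Fin m) (Fin n) ℝ} (hQ : IsUnit Q)
    (hB : Qᵀ * B = Cᵀ) (hE : (Qᵀ * E).PosSemidef) (hA : ∀ v, v ⬝ᵥ (Qᵀ * A) *ᵥ v ≤ 0) :
    IsPortHamiltonian E A B C := by
  have hdet := (Matrix.isUnit_iff_isUnit_det _).1 hQ
  have hM : A * Q⁻¹ * Q = A := by rw [Matrix.mul_assoc, nonsing_inv_mul _ hdet, Matrix.mul_one]
  obtain ⟨M, hM'⟩ : ∃ M, M = A * Q⁻¹ := ⟨_, rfl⟩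
  rw [← hM'] at hM
  have hsym : ((2⁻¹ : ℝ) • -(M + Mᵀ))ᵀ = (2⁻¹ : ℝ) • -(M + Mᵀ) := by
    simp [add_comm]
  refine ⟨(2⁻¹ : ℝ) • (M - Mᵀ), (2⁻¹ : ℝ) • -(M + Mᵀ), Q, B, 0, ?_, by simp, ?_, ?_, ?_, hE,
    by rw [hsym], ?_, by simp⟩
  · rw [← smul_sub, show M - Mᵀ - -(M + Mᵀ) = (2 : ℝ) • M by rw [two_smul]; abel, smul_smul]
    norm_num [hM]
  · rw [add_zero, ← transpose_transpose Q, ← transpose_mul, hB, transpose_transpose]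
  · rw [transpose_smul, transpose_sub, transpose_transpose, ← smul_neg, neg_sub]
  · have := hE.1.eq
    rw [conjTranspose_eq_transpose_of_trivial, transpose_mul, transpose_transpose] at this
    exact this.symm
  · refine .of_dotProduct_mulVec_nonneg ?_ fun v => ?_
    · rw [IsHermitian, conjTranspose_eq_transpose_of_trivial, transpose_mul, transpose_mul,
        transpose_transpose, hsym, Matrix.mul_assoc]
    · have h1 : v ⬝ᵥ (Qᵀ * Mᵀ * Q) *ᵥ v = v ⬝ᵥ (Qᵀ * A) *ᵥ v := by
        rw [show Qᵀ * Mᵀ * Q = (Qᵀ * A)ᵀ by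
          rw [← transpose_mul, hM, transpose_mul, transpose_transpose], mulVec_transpose,
          dotProduct_comm, ← dotProduct_mulVec]
      have h2 : Qᵀ * M * Q = Qᵀ * A := by rw [Matrix.mul_assoc, hM]
      rw [star_trivial, Matrix.mul_smul, Matrix.smul_mul, smul_mulVec, dotProduct_smul,
        Matrix.mul_neg, Matrix.neg_mul, Matrix.mul_add, Matrix.add_mul, neg_mulVec, add_mulVec,
        dotProduct_neg, dotProduct_add, h1, h2, smul_eq_mul]
      linarith [hA v]

/-- A completely observable port-Hamiltonian system becomes, on multiplication by a nonsingular
matrix, one with positive semidefinite `E`, dissipative `A` and `B = Cᵀ`. -/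
theorem IsPortHamiltonian.exists_isUnit {n m : ℕ} {E A : Matrix (Fin n) (Fin n) ℝ}
    {B : Matrix (Fin n) (Fin m) ℝ} {C : Matrix (Fin m) (Fin n) ℝ}
    (h : IsPortHamiltonian E A B C) (hobs : IsCompletelyObservable E A C) :
    ∃ Q : Matrix (Fin n) (Fin n) ℝ, IsUnit Q ∧ Qᵀ * B = Cᵀ ∧ (Qᵀ * E).PosSemidef ∧
      (∀ v, v ⬝ᵥ (Qᵀ * A) *ᵥ v ≤ 0) ∧ ∀ v, (Qᵀ * E) *ᵥ v = 0 → C *ᵥ v = 0 → v = 0 := by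
  obtain ⟨Q, hB, hE, hA, hQ⟩ := h.exists_transpose_mul_eq
  have hQu : IsUnit Q := isUnit_of_mulVec_eq_zero fun v hv =>
    hobs.eq_zero (a := 0) (b := 1) (by simp) (by simp [neg_mulVec, (hQ v hv).1]) (hQ v hv).2
  refine ⟨Q, hQu, hB, hE, hA, fun v hv hC => ?_⟩
  refine hobs.eq_zero (a := 1) (b := 0) (by simp) ?_ hC
  rw [← mulVec_mulVec] at hv
  have hQt : IsUnit Qᵀ := (Matrix.isUnit_transpose _).2 hQu
  simpa using (Matrix.mulVec_injective_iff_isUnit.2 hQt) (hv.trans (mulVec_zero _).symm)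

theorem isRegularIndexLEOne_mul_iff {n : ℕ} {E A Q : Matrix (Fin n) (Fin n) ℝ} (hQ : IsUnit Q) :
    IsRegularIndexLEOne (Q * E) (Q * A) ↔ IsRegularIndexLEOne E A := by
  have hinj := Matrix.mulVec_injective_iff_isUnit.2 hQ
  simp_rw [isRegularIndexLEOne_iff, ← mulVec_mulVec]
  refine forall₂_congr fun v w => ?_
  rw [hinj.eq_iff, show Q *ᵥ (E *ᵥ v) = 0 ↔ E *ᵥ v = 0 by
    rw [← hinj.eq_iff (a := E *ᵥ v), mulVec_zero]]

end PortHamiltonian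

/-! ### The canonical section of `C` and the feedback it parametrizes. -/

section OutputSection

open Matrix

variable {n m : ℕ} {E A : Matrix (Fin n) (Fin n) ℝ} {C : Matrix (Fin m) (Fin n) ℝ}
  {S : Matrix (Fin n) (Fin m) ℝ} {W X : Matrix (Fin m) (Fin m) ℝ}

theorem dotProduct_transpose_mulVec_comm {a b : ℕ} (M : Matrix (Fin a) (Fin b) ℝ) (x : Fin b → ℝ)
    (y : Fin a → ℝ) : x ⬝ᵥ Mᵀ *ᵥ y = (M *ᵥ x) ⬝ᵥ y := by
  rw [mulVec_transpose, dotProduct_comm, ← dotProduct_mulVec, dotProduct_comm]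

/-- Here `vᵀ E v = (C v)ᵀ y = 0`, so `E v = 0` by semidefiniteness. Uniqueness of the section rests
on this. -/
theorem eq_zero_of_mulVec_eq_transpose (hE : E.PosSemidef)
    (hEC : ∀ v, E *ᵥ v = 0 → C *ᵥ v = 0 → v = 0) {v : Fin n → ℝ} {y : Fin m → ℝ}
    (hv : E *ᵥ v = Cᵀ *ᵥ y) (hC : C *ᵥ v = 0) : v = 0 := by
  refine hEC v ((hE.dotProduct_mulVec_zero_iff v).1 ?_) hC
  rw [star_trivial, hv, dotProduct_transpose_mulVec_comm, hC, zero_dotProduct]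

theorem mulVec_section_eq (hE : E.PosSemidef) (hEC : ∀ v, E *ᵥ v = 0 → C *ᵥ v = 0 → v = 0)
    (hCS : C * S = 1) (hES : E * S = Cᵀ * W) {v : Fin n → ℝ} {y : Fin m → ℝ}
    (hv : E *ᵥ v = Cᵀ *ᵥ y) : S *ᵥ (C *ᵥ v) = v := by
  refine (sub_eq_zero.1 (eq_zero_of_mulVec_eq_transpose hE hEC (y := y - W *ᵥ (C *ᵥ v)) ?_ ?_)).symm
  · rw [mulVec_sub, mulVec_sub, hv, mulVec_mulVec, mulVec_mulVec _ Cᵀ, hES]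
  · rw [mulVec_sub, mulVec_mulVec _ C, hCS, one_mulVec, sub_self]

theorem section_unique (hE : E.PosSemidef) (hEC : ∀ v, E *ᵥ v = 0 → C *ᵥ v = 0 → v = 0)
    (hCS : C * S = 1) (hES : E * S = Cᵀ * W) {S' : Matrix (Fin n) (Fin m) ℝ}
    {W' : Matrix (Fin m) (Fin m) ℝ} (hCS' : C * S' = 1) (hES' : E * S' = Cᵀ * W') : S' = S := by
  refine Matrix.ext_of_mulVec_single fun i => ?_
  have := mulVec_section_eq hE hEC hCS hES (v := S' *ᵥ Pi.single i 1) (y := W' *ᵥ Pi.single i 1)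
    (by rw [mulVec_mulVec, mulVec_mulVec, hES'])
  rw [← this, mulVec_mulVec _ C, hCS', one_mulVec]

theorem isUnit_mul_of_mul_eq (hE : E.PosSemidef) (hEC : ∀ v, E *ᵥ v = 0 → C *ᵥ v = 0 → v = 0)
    (hS : ∀ x, S *ᵥ x = 0 → x = 0) (hES : E * S = Cᵀ * W) : IsUnit (C * S) := by
  refine isUnit_of_mulVec_eq_zero fun x hx => hS x ?_
  refine eq_zero_of_mulVec_eq_transpose hE hEC (y := W *ᵥ x) ?_ (by rw [mulVec_mulVec, hx])
  rw [mulVec_mulVec, mulVec_mulVec, hES]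

theorem exists_section (hE : E.PosSemidef) (hEC : ∀ v, E *ᵥ v = 0 → C *ᵥ v = 0 → v = 0)
    (hC : C.rank = m) :
    ∃ (S : Matrix (Fin n) (Fin m) ℝ) (W : Matrix (Fin m) (Fin m) ℝ),
      C * S = 1 ∧ E * S = Cᵀ * W := by
  have hCt : ∀ y, Cᵀ *ᵥ y = 0 → y = 0 := by
    have h1 := finrank_ker_mulVecLin_add_rank Cᵀ
    rw [Matrix.rank_transpose, hC] at h1
    have h2 : LinearMap.ker Cᵀ.mulVecLin = ⊥ := Submodule.finrank_eq_zero.1 (by omega)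
    exact LinearMap.ker_eq_bot'.1 h2
  have hG : IsUnit (E + Cᵀ * C) := isUnit_of_mulVec_eq_zero fun v hv => by
    rw [add_mulVec, ← mulVec_mulVec] at hv
    have h1 : v ⬝ᵥ E *ᵥ v + (C *ᵥ v) ⬝ᵥ (C *ᵥ v) = 0 := by
      rw [← dotProduct_transpose_mulVec_comm, ← dotProduct_add, hv, dotProduct_zero]
    have h2 := hE.dotProduct_mulVec_nonneg v
    rw [star_trivial] at h2
    have h3 : 0 ≤ (C *ᵥ v) ⬝ᵥ (C *ᵥ v) := Finset.sum_nonneg fun i _ => mul_self_nonneg _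
    refine hEC v ((hE.dotProduct_mulVec_zero_iff v).1 ?_) (dotProduct_self_eq_zero.1 ?_)
    · rw [star_trivial]; linarith
    · linarith
  have hGd := (Matrix.isUnit_iff_isUnit_det _).1 hG
  -- With `G = E + Cᵀ C`, positive definite, `T = G⁻¹ Cᵀ` satisfies `E T = Cᵀ (1 - C T)`; only the
  -- normalization `C T = 1` is missing.
  obtain ⟨T, hT⟩ : ∃ T, (E + Cᵀ * C) * T = Cᵀ :=
    ⟨(E + Cᵀ * C)⁻¹ * Cᵀ, by rw [← Matrix.mul_assoc, mul_nonsing_inv _ hGd, Matrix.one_mul]⟩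
  have hET : E * T = Cᵀ * (1 - C * T) := by
    rw [Matrix.add_mul] at hT
    rw [Matrix.mul_sub, Matrix.mul_one, ← Matrix.mul_assoc]
    exact eq_sub_of_add_eq hT
  have hCT : IsUnit (C * T) := isUnit_mul_of_mul_eq hE hEC (fun x hx => hCt x (by
    rw [← hT, ← mulVec_mulVec, hx, mulVec_zero])) hET
  have hCTd := (Matrix.isUnit_iff_isUnit_det _).1 hCT
  exact ⟨T * (C * T)⁻¹, (1 - C * T) * (C * T)⁻¹, by
    rw [← Matrix.mul_assoc, mul_nonsing_inv _ hCTd], by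
    rw [← Matrix.mul_assoc, hET, Matrix.mul_assoc]⟩

theorem exists_normalized_of_mul_eq (hCS : IsUnit (C * S)) (hES : E * S = Cᵀ * W) :
    C * (S * (C * S)⁻¹) = 1 ∧ ∃ W' : Matrix (Fin m) (Fin m) ℝ, E * (S * (C * S)⁻¹) = Cᵀ * W' := by
  have hd := (Matrix.isUnit_iff_isUnit_det _).1 hCS
  exact ⟨by rw [← Matrix.mul_assoc, mul_nonsing_inv _ hd], W * (C * S)⁻¹, by
    rw [← Matrix.mul_assoc, hES, Matrix.mul_assoc]⟩

/-- The effect on `E` of the derivative feedback that replaces `Sᵀ E S` by `X`. -/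
theorem feedback_mul_section (hCS : C * S = 1) (hES : E * S = Cᵀ * W) :
    (E + Cᵀ * (X - W) * C) * S = Cᵀ * X := by
  rw [Matrix.add_mul, hES, Matrix.mul_assoc (Cᵀ * (X - W)), hCS, Matrix.mul_one, ← Matrix.mul_add,
    add_sub_cancel]

/-- A kernel vector has `E v ∈ im Cᵀ`, hence `v = S (C v)`; applying `Sᵀ` then leaves `X (C v) = 0`.
-/
theorem feedback_mulVec_eq_zero_iff (hE : E.PosSemidef)
    (hEC : ∀ v, E *ᵥ v = 0 → C *ᵥ v = 0 → v = 0) (hCS : C * S = 1) (hES : E * S = Cᵀ * W)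
    {v : Fin n → ℝ} :
    (E + Cᵀ * (X - W) * C) *ᵥ v = 0 ↔ ∃ x, X *ᵥ x = 0 ∧ S *ᵥ x = v := by
  constructor
  · intro hv
    have h1 : E *ᵥ v = Cᵀ *ᵥ (-((X - W) *ᵥ (C *ᵥ v))) := by
      rw [add_mulVec, ← mulVec_mulVec, ← mulVec_mulVec] at hv
      rw [mulVec_neg]
      exact eq_neg_of_add_eq_zero_left hv
    have h2 := mulVec_section_eq hE hEC hCS hES h1
    refine ⟨C *ᵥ v, ?_, h2⟩
    have h3 : Sᵀ *ᵥ ((E + Cᵀ * (X - W) * C) *ᵥ (S *ᵥ (C *ᵥ v))) = X *ᵥ (C *ᵥ v) := by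
      rw [mulVec_mulVec _ _ S, feedback_mul_section hCS hES, mulVec_mulVec, ← Matrix.mul_assoc,
        ← transpose_mul, hCS, transpose_one, Matrix.one_mul]
    rw [← h3, h2, hv, mulVec_zero]
  · rintro ⟨x, hx, rfl⟩
    rw [mulVec_mulVec, feedback_mul_section hCS hES, ← mulVec_mulVec, hx, mulVec_zero]

theorem finrank_ker_add_rank_feedback (hE : E.PosSemidef)
    (hEC : ∀ v, E *ᵥ v = 0 → C *ᵥ v = 0 → v = 0) (hCS : C * S = 1) (hES : E * S = Cᵀ * W) :
    Module.finrank ℝ (LinearMap.ker X.mulVecLin) + (E + Cᵀ * (X - W) * C).rank = n := by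
  have h1 : LinearMap.ker (E + Cᵀ * (X - W) * C).mulVecLin
      = (LinearMap.ker X.mulVecLin).map S.mulVecLin := by
    ext v
    exact feedback_mulVec_eq_zero_iff hE hEC hCS hES
  have hS : Function.Injective S.mulVecLin := Function.LeftInverse.injective (g := C.mulVecLin)
    fun x => by rw [mulVecLin_apply, mulVecLin_apply, mulVec_mulVec, hCS, one_mulVec]
  have h2 := finrank_ker_mulVecLin_add_rank (E + Cᵀ * (X - W) * C)
  rwa [h1, ← (Submodule.equivMapOfInjective S.mulVecLin hS _).finrank_eq] at h2

theorem posSemidef_feedback (hE : E.PosSemidef) (hCS : C * S = 1) (hES : E * S = Cᵀ * W)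
    (hX : X.PosSemidef) : (E + Cᵀ * (X - W) * C).PosSemidef := by
  have hEt : Eᵀ = E := by simpa using hE.1.eq
  have hSC : Sᵀ * Cᵀ = 1 := by rw [← transpose_mul, hCS, transpose_one]
  have hSE : Sᵀ * E = Wᵀ * C := by
    rw [← hEt, ← transpose_mul, hES, transpose_mul, transpose_transpose]
  have hW : Wᵀ = W := by
    have h1 : Sᵀ * (E * S) = W := by
      rw [hES, ← Matrix.mul_assoc, hSC, Matrix.one_mul]
    rw [← Matrix.mul_assoc, hSE, Matrix.mul_assoc, hCS, Matrix.mul_one] at h1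
    exact h1
  -- The range of `S` and `ker C` are `E`-orthogonal, so `E` splits and feedback replaces only the
  -- block `W = Sᵀ E S`.
  have key : E + Cᵀ * (X - W) * C = Cᵀ * X * C + (1 - S * C)ᵀ * E * (1 - S * C) := by
    have h1 : (1 - S * C)ᵀ * E = E - Cᵀ * W * C := by
      rw [transpose_sub, transpose_one, transpose_mul, Matrix.sub_mul, Matrix.one_mul,
        Matrix.mul_assoc, hSE, hW, Matrix.mul_assoc]
    have h2 : (E - Cᵀ * W * C) * (S * C) = 0 := by
      rw [← Matrix.mul_assoc, Matrix.sub_mul, hES, Matrix.mul_assoc _ C S, hCS, Matrix.mul_one,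
        sub_self, Matrix.zero_mul]
    rw [h1, Matrix.mul_sub (E - _), h2, Matrix.mul_one, sub_zero, Matrix.mul_sub, Matrix.sub_mul]
    abel
  rw [key]
  have h1 := hX.conjTranspose_mul_mul_same C
  have h2 := hE.conjTranspose_mul_mul_same (1 - S * C)
  rw [conjTranspose_eq_transpose_of_trivial] at h1 h2
  exact h1.add h2

theorem isRegularIndexLEOne_feedback_iff (hE : E.PosSemidef)
    (hEC : ∀ v, E *ᵥ v = 0 → C *ᵥ v = 0 → v = 0) (hCS : C * S = 1) (hES : E * S = Cᵀ * W)
    (hsym : (E + Cᵀ * (X - W) * C)ᵀ = E + Cᵀ * (X - W) * C) :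
    IsRegularIndexLEOne (E + Cᵀ * (X - W) * C) A ↔
      IsNondegenerateOn (Matrix.toLinearMap₂' ℝ (Sᵀ * A * S)) (LinearMap.ker X.mulVecLin) := by
  have hker := fun v => feedback_mulVec_eq_zero_iff (X := X) (v := v) hE hEC hCS hES
  have hform : ∀ x y, Matrix.toLinearMap₂' ℝ (Sᵀ * A * S) y x = (S *ᵥ y) ⬝ᵥ A *ᵥ (S *ᵥ x) :=
    fun x y => by
      rw [Matrix.toLinearMap₂'_apply', ← mulVec_mulVec, ← mulVec_mulVec,
        dotProduct_transpose_mulVec_comm]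
  have hSinj : ∀ x, S *ᵥ x = 0 → x = 0 := fun x hx => by
    rw [← one_mulVec x, ← hCS, ← mulVec_mulVec, hx, mulVec_zero]
  obtain ⟨F, hF⟩ : ∃ F, F = E + Cᵀ * (X - W) * C := ⟨_, rfl⟩
  rw [← hF] at hker hsym ⊢
  rw [isRegularIndexLEOne_iff]
  constructor
  · intro h x hx hxy
    have hx' : X *ᵥ x = 0 := hx
    obtain ⟨w, hw⟩ := exists_transpose_mulVec_eq (C := F) (w := A *ᵥ (S *ᵥ x)) fun v hv => by
      obtain ⟨y, hy, rfl⟩ := (hker _).1 hv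
      rw [dotProduct_comm, ← hform]
      exact hxy y hy
    rw [hsym] at hw
    exact hSinj x (h _ w ((hker _).2 ⟨x, hx', rfl⟩) hw.symm)
  · intro h v w hv hw
    obtain ⟨x, hx, rfl⟩ := (hker _).1 hv
    rw [h x hx fun y hy => ?_, mulVec_zero]
    rw [hform, hw, ← hsym, dotProduct_transpose_mulVec_comm, (hker _).2 ⟨y, hy, rfl⟩, zero_dotProduct]

/-- Feedback that keeps the closed loop port-Hamiltonian keeps `E` symmetric. -/
theorem feedback_symm (hCS : C * S = 1) (hES : E * S = Cᵀ * W) {Z : Matrix (Fin n) (Fin n) ℝ}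
    (hZ : C * Z = C) (h : (Zᵀ * (E + Cᵀ * (X - W) * C))ᵀ = Zᵀ * (E + Cᵀ * (X - W) * C)) :
    Xᵀ = X := by
  have h1 : Sᵀ * (Zᵀ * (E + Cᵀ * (X - W) * C)) * S = X := by
    rw [Matrix.mul_assoc, Matrix.mul_assoc, feedback_mul_section hCS hES, ← Matrix.mul_assoc Zᵀ,
      ← transpose_mul, hZ, ← Matrix.mul_assoc, ← transpose_mul, hCS, transpose_one, Matrix.one_mul]
  conv_lhs => rw [← h1]
  rw [transpose_mul, transpose_mul, h, transpose_transpose, ← Matrix.mul_assoc, h1]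

end OutputSection

/-! ### Attainable ranks in dissipative form. -/

section Feedback

open Matrix

theorem skew_toLinearMap₂'_iff {m : ℕ} {M : Matrix (Fin m) (Fin m) ℝ} :
    (∀ x y, (Matrix.toLinearMap₂' ℝ M : (Fin m → ℝ) →ₗ[ℝ] (Fin m → ℝ) →ₗ[ℝ] ℝ) x y =
      -(Matrix.toLinearMap₂' ℝ M : (Fin m → ℝ) →ₗ[ℝ] (Fin m → ℝ) →ₗ[ℝ] ℝ) y x) ↔ Mᵀ = -M := by
  constructor
  · intro h
    ext i j
    have := h (Pi.single j 1) (Pi.single i 1)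
    simpa [Matrix.toLinearMap₂'_apply'] using this
  · intro h x y
    rw [Matrix.toLinearMap₂'_apply', Matrix.toLinearMap₂'_apply', ← dotProduct_neg, ← neg_mulVec,
      ← h, dotProduct_transpose_mulVec_comm, dotProduct_comm]

theorem ker_flip_toLinearMap₂' {m : ℕ} (M : Matrix (Fin m) (Fin m) ℝ) :
    LinearMap.ker (Matrix.toLinearMap₂' ℝ M : (Fin m → ℝ) →ₗ[ℝ] (Fin m → ℝ) →ₗ[ℝ] ℝ).flip =
      LinearMap.ker M.mulVecLin := by
  ext x
  rw [LinearMap.mem_ker, LinearMap.mem_ker, mulVecLin_apply, LinearMap.ext_iff]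
  simp only [LinearMap.flip_apply, Matrix.toLinearMap₂'_apply', LinearMap.zero_apply]
  exact ⟨fun h => dotProduct_eq_zero _ fun y => by rw [dotProduct_comm, h],
    fun h y => by rw [h, dotProduct_zero]⟩

theorem IsNondegenerateOn.finrank_le_rank {m : ℕ} {M : Matrix (Fin m) (Fin m) ℝ}
    {U : Submodule ℝ (Fin m → ℝ)} (hU : IsNondegenerateOn (Matrix.toLinearMap₂' ℝ M) U) :
    Module.finrank ℝ U ≤ M.rank := by
  have hd : Disjoint U (LinearMap.ker M.mulVecLin) := Submodule.disjoint_def.2 fun x hxU hx => by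
    refine hU x hxU fun y _ => ?_
    rw [Matrix.toLinearMap₂'_apply', show M *ᵥ x = 0 from hx, dotProduct_zero]
  have h1 := Submodule.finrank_add_finrank_le_of_disjoint hd
  have h2 := finrank_ker_mulVecLin_add_rank M
  rw [Module.finrank_fin_fun] at h1
  omega

/-- A skew form is nondegenerate on any complement of its kernel. -/
theorem even_rank_of_transpose_eq_neg {m : ℕ} {M : Matrix (Fin m) (Fin m) ℝ} (h : Mᵀ = -M) :
    Even M.rank := by
  obtain ⟨L, hL⟩ := Submodule.exists_isCompl (LinearMap.ker M.mulVecLin)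
  have hnd : IsNondegenerateOn (Matrix.toLinearMap₂' ℝ M) L := by
    intro x hx hxy
    refine Submodule.disjoint_def.1 hL.disjoint x ?_ hx
    refine dotProduct_eq_zero _ fun y => ?_
    obtain ⟨u, hu, v, hv, rfl⟩ := Submodule.mem_sup.1
      (show y ∈ LinearMap.ker M.mulVecLin ⊔ L by rw [hL.sup_eq_top]; trivial)
    have hu' : M *ᵥ u = 0 := hu
    have h1 := hxy v hv
    rw [Matrix.toLinearMap₂'_apply'] at h1
    have h2 : u ⬝ᵥ M *ᵥ x = 0 := by
      rw [← neg_neg M, ← h, neg_mulVec, dotProduct_neg, dotProduct_transpose_mulVec_comm, hu',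
        zero_dotProduct, neg_zero]
    rw [mulVecLin_apply, dotProduct_comm, add_dotProduct, h1, h2, add_zero]
  have h1 := Submodule.finrank_add_eq_of_isCompl hL
  have h2 := finrank_ker_mulVecLin_add_rank M
  rw [Module.finrank_fin_fun] at h1
  rw [show M.rank = Module.finrank ℝ L by omega]
  exact hnd.even_finrank (skew_toLinearMap₂'_iff.2 h)

variable {n m : ℕ} {E A : Matrix (Fin n) (Fin n) ℝ} {C : Matrix (Fin m) (Fin n) ℝ}
  {S : Matrix (Fin n) (Fin m) ℝ} {W X : Matrix (Fin m) (Fin m) ℝ}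

theorem rank_feedback_of_isRegularIndexLEOne (hE : E.PosSemidef)
    (hEC : ∀ v, E *ᵥ v = 0 → C *ᵥ v = 0 → v = 0) (hCS : C * S = 1) (hES : E * S = Cᵀ * W)
    (hsym : (E + Cᵀ * (X - W) * C)ᵀ = E + Cᵀ * (X - W) * C)
    (hreg : IsRegularIndexLEOne (E + Cᵀ * (X - W) * C) A) :
    ∃ k, k + (E + Cᵀ * (X - W) * C).rank = n ∧ k ≤ (Sᵀ * A * S).rank ∧
      ((Sᵀ * A * S)ᵀ = -(Sᵀ * A * S) → Even k) := by
  have hU := (isRegularIndexLEOne_feedback_iff hE hEC hCS hES hsym).1 hreg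
  exact ⟨_, finrank_ker_add_rank_feedback hE hEC hCS hES, hU.finrank_le_rank,
    fun h => hU.even_finrank (skew_toLinearMap₂'_iff.2 h)⟩

theorem exists_feedback_of_isNondegenerateOn (hE : E.PosSemidef)
    (hEC : ∀ v, E *ᵥ v = 0 → C *ᵥ v = 0 → v = 0) (hCS : C * S = 1) (hES : E * S = Cᵀ * W)
    {U : Submodule ℝ (Fin m → ℝ)}
    (hU : IsNondegenerateOn (Matrix.toLinearMap₂' ℝ (Sᵀ * A * S)) U) :
    ∃ K : Matrix (Fin m) (Fin m) ℝ, (E + Cᵀ * K * C).PosSemidef ∧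
      Module.finrank ℝ U + (E + Cᵀ * K * C).rank = n ∧
      IsRegularIndexLEOne (E + Cᵀ * K * C) A := by
  obtain ⟨X, hX, rfl⟩ := exists_posSemidef_ker_eq U
  have hpsd := posSemidef_feedback hE hCS hES hX
  exact ⟨X - W, hpsd, finrank_ker_add_rank_feedback hE hEC hCS hES,
    (isRegularIndexLEOne_feedback_iff hE hEC hCS hES (by simpa using hpsd.1.eq)).2 hU⟩

theorem exists_feedback_of_le_rank (hE : E.PosSemidef)
    (hEC : ∀ v, E *ᵥ v = 0 → C *ᵥ v = 0 → v = 0) (hA : ∀ v, v ⬝ᵥ A *ᵥ v ≤ 0)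
    (hCS : C * S = 1) (hES : E * S = Cᵀ * W) {k : ℕ} (hk : k ≤ (Sᵀ * A * S).rank)
    (hskew : (Sᵀ * A * S)ᵀ = -(Sᵀ * A * S) → Even k) :
    ∃ K : Matrix (Fin m) (Fin m) ℝ, (E + Cᵀ * K * C).PosSemidef ∧
      k + (E + Cᵀ * K * C).rank = n ∧ IsRegularIndexLEOne (E + Cᵀ * K * C) A := by
  obtain ⟨U, rfl, hU⟩ := exists_isNondegenerateOn_finrank_eq
    (a := Matrix.toLinearMap₂' ℝ (Sᵀ * A * S)) (k := k)
    (fun x => by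
      rw [Matrix.toLinearMap₂'_apply', ← mulVec_mulVec, ← mulVec_mulVec,
        dotProduct_transpose_mulVec_comm]
      exact hA _)
    (by
      have := finrank_ker_mulVecLin_add_rank (Sᵀ * A * S)
      rw [ker_flip_toLinearMap₂', Module.finrank_fin_fun]
      omega)
    (fun h => hskew (skew_toLinearMap₂'_iff.1 h))
  exact exists_feedback_of_isNondegenerateOn hE hEC hCS hES hU

/-- Output damping `A - Cᵀ C` makes every rank between `n - rank C` and `n` attainable. -/
theorem exists_damped_feedback (hE : E.PosSemidef)
    (hEC : ∀ v, E *ᵥ v = 0 → C *ᵥ v = 0 → v = 0) (hA : ∀ v, v ⬝ᵥ A *ᵥ v ≤ 0)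
    {k : ℕ} (hk : k ≤ C.rank) :
    ∃ K : Matrix (Fin m) (Fin m) ℝ, (E + Cᵀ * K * C).PosSemidef ∧
      k + (E + Cᵀ * K * C).rank = n ∧ IsRegularIndexLEOne (E + Cᵀ * K * C) (A - Cᵀ * C) := by
  obtain ⟨D, M, hD, hDM, hDC⟩ := exists_fullRowRank_factor C
  have hED : ∀ v, E *ᵥ v = 0 → D *ᵥ v = 0 → v = 0 := fun v h1 h2 => hEC v h1 (hDC v h2)
  obtain ⟨S, W, hDS, hES⟩ := exists_section hE hED hD
  obtain ⟨U, -, -, hU⟩ := exists_submodule_between_finrank_eq (k := k)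
    (bot_le : (⊥ : Submodule ℝ (Fin C.rank → ℝ)) ≤ ⊤) (by rw [finrank_bot]; omega)
    (by rw [finrank_top, Module.finrank_fin_fun]; exact hk)
  -- The damped form is negative definite, so every `U` qualifies.
  have hnd : IsNondegenerateOn (Matrix.toLinearMap₂' ℝ (Sᵀ * (A - Cᵀ * C) * S)) U := by
    intro x hx h
    have h1 := h x hx
    rw [Matrix.toLinearMap₂'_apply', ← mulVec_mulVec, ← mulVec_mulVec,
      dotProduct_transpose_mulVec_comm, sub_mulVec, dotProduct_sub, ← mulVec_mulVec,
      dotProduct_transpose_mulVec_comm] at h1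
    have h2 := hA (S *ᵥ x)
    have h3 : 0 ≤ (C *ᵥ (S *ᵥ x)) ⬝ᵥ (C *ᵥ (S *ᵥ x)) :=
      Finset.sum_nonneg fun i _ => mul_self_nonneg _
    have h4 : C *ᵥ (S *ᵥ x) = 0 := dotProduct_self_eq_zero.1 (by linarith)
    rw [← one_mulVec x, ← hDS, ← mulVec_mulVec, hDM, ← mulVec_mulVec, h4, mulVec_zero]
  obtain ⟨K, hK⟩ := exists_feedback_of_isNondegenerateOn hE hED hDS hES hnd
  refine ⟨Mᵀ * K * M, ?_⟩
  rwa [hU, show Dᵀ * K * D = Cᵀ * (Mᵀ * K * M) * C by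
    rw [hDM, transpose_mul]; simp only [Matrix.mul_assoc]] at hK

theorem le_rank_feedback_add_rank (hEC : ∀ v, E *ᵥ v = 0 → C *ᵥ v = 0 → v = 0)
    (L : Matrix (Fin n) (Fin m) ℝ) : n ≤ (E + L * C).rank + C.rank := by
  have hd : Disjoint (LinearMap.ker (E + L * C).mulVecLin) (LinearMap.ker C.mulVecLin) :=
    Submodule.disjoint_def.2 fun v hv hC => by
      have hv' : (E + L * C) *ᵥ v = 0 := hv
      have hC' : C *ᵥ v = 0 := hC
      rw [add_mulVec, ← mulVec_mulVec, hC', mulVec_zero, add_zero] at hv'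
      exact hEC v hv' hC'
  have h1 := Submodule.finrank_add_finrank_le_of_disjoint hd
  have h2 := finrank_ker_mulVecLin_add_rank (E + L * C)
  have h3 := finrank_ker_mulVecLin_add_rank C
  rw [Module.finrank_fin_fun] at h1
  omega

end Feedback

/-! ### Transfer to the original system. -/

section Main

open Matrix

variable {n m : ℕ} {E A Q : Matrix (Fin n) (Fin n) ℝ} {B : Matrix (Fin n) (Fin m) ℝ}
  {C : Matrix (Fin m) (Fin n) ℝ}

theorem transpose_mul_feedback (hB : Qᵀ * B = Cᵀ) (M : Matrix (Fin n) (Fin n) ℝ)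
    (K : Matrix (Fin m) (Fin m) ℝ) : Qᵀ * (M + B * K * C) = Qᵀ * M + Cᵀ * K * C := by
  rw [Matrix.mul_add, ← Matrix.mul_assoc, ← Matrix.mul_assoc, hB]

theorem rank_transpose_mul_of_isUnit {k : ℕ} (hQ : IsUnit Q) (M : Matrix (Fin n) (Fin k) ℝ) :
    (Qᵀ * M).rank = M.rank :=
  rank_mul_eq_right_of_isUnit_det _ _
    ((Matrix.isUnit_iff_isUnit_det _).1 ((Matrix.isUnit_transpose _).2 hQ))

/-- If the closed loop is port-Hamiltonian, the feedback gain makes `Qᵀ (E + B K C)` symmetric. -/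
theorem feedback_transpose_eq_of_isPortHamiltonian {S : Matrix (Fin n) (Fin m) ℝ}
    {W K : Matrix (Fin m) (Fin m) ℝ} (hQ : IsUnit Q) (hB : Qᵀ * B = Cᵀ)
    (hE : (Qᵀ * E).PosSemidef) (hCS : C * S = 1) (hES : Qᵀ * E * S = Cᵀ * W)
    (h : IsPortHamiltonian (E + B * K * C) A B C) :
    (Qᵀ * E + Cᵀ * K * C)ᵀ = Qᵀ * E + Cᵀ * K * C := by
  obtain ⟨Q', hB', hE', -⟩ := h.exists_transpose_mul_eq
  have hdet := (Matrix.isUnit_iff_isUnit_det _).1 hQ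
  -- The closed loop may use another `Q'`, but `Q'ᵀ B = Cᵀ = Qᵀ B` forces `Z = Q⁻¹ Q'` to satisfy `C
  -- Z = C`, which is all `feedback_symm` needs.
  have hQZ : Q * (Q⁻¹ * Q') = Q' := by
    rw [← Matrix.mul_assoc, mul_nonsing_inv _ hdet, Matrix.one_mul]
  obtain ⟨Z, hZ⟩ : ∃ Z, Z = Q⁻¹ * Q' := ⟨_, rfl⟩
  rw [← hZ] at hQZ
  have hsymE : (Qᵀ * E)ᵀ = Qᵀ * E := by simpa using hE.1.eq
  have hCZ : C * Z = C := by
    have hC : C = Bᵀ * Q := by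
      rw [← transpose_transpose C, ← hB, transpose_mul, transpose_transpose]
    rw [hC, Matrix.mul_assoc, hQZ, ← hC, ← transpose_transpose C, ← hB', transpose_mul,
      transpose_transpose]
  have hKX : Qᵀ * E + Cᵀ * (K + W - W) * C = Qᵀ * E + Cᵀ * K * C := by
    rw [add_sub_cancel_right]
  have hX : (K + W)ᵀ = K + W := feedback_symm hCS hES hCZ (by
    rw [hKX, ← transpose_mul_feedback hB, ← Matrix.mul_assoc, ← transpose_mul, hQZ]
    simpa using hE'.1.eq)
  have hW : Wᵀ = W := by
    have h1 : Sᵀ * (Qᵀ * E * S) = W := by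
      rw [hES, ← Matrix.mul_assoc, ← transpose_mul, hCS, transpose_one, Matrix.one_mul]
    rw [← h1, transpose_mul, transpose_mul, hsymE, transpose_transpose, Matrix.mul_assoc]
  have hK : Kᵀ = K := by
    rw [transpose_add, hW] at hX
    exact add_right_cancel hX
  rw [transpose_add, hsymE, transpose_mul, transpose_mul, hK, transpose_transpose, Matrix.mul_assoc]

theorem derivative_feedback_iff {S : Matrix (Fin n) (Fin m) ℝ} {W : Matrix (Fin m) (Fin m) ℝ}
    (hQ : IsUnit Q) (hB : Qᵀ * B = Cᵀ) (hE : (Qᵀ * E).PosSemidef)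
    (hA : ∀ v, v ⬝ᵥ (Qᵀ * A) *ᵥ v ≤ 0) (hEC : ∀ v, (Qᵀ * E) *ᵥ v = 0 → C *ᵥ v = 0 → v = 0)
    (hCS : C * S = 1) (hES : Qᵀ * E * S = Cᵀ * W) (r : ℕ) :
    (∃ K : Matrix (Fin m) (Fin m) ℝ, IsRegularIndexLEOne (E + B * K * C) A ∧
        (E + B * K * C).rank = r ∧ IsPortHamiltonian (E + B * K * C) A B C) ↔
      ∃ k, k + r = n ∧ k ≤ (Sᵀ * (Qᵀ * A) * S).rank ∧
        ((Sᵀ * (Qᵀ * A) * S)ᵀ = -(Sᵀ * (Qᵀ * A) * S) → Even k) := by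
  have hQt : IsUnit Qᵀ := (Matrix.isUnit_transpose _).2 hQ
  constructor
  · rintro ⟨K, hreg, rfl, hK⟩
    have hsym := feedback_transpose_eq_of_isPortHamiltonian hQ hB hE hCS hES hK
    rw [← isRegularIndexLEOne_mul_iff hQt, transpose_mul_feedback hB] at hreg
    rw [← rank_transpose_mul_of_isUnit hQ, transpose_mul_feedback hB]
    have hKX : K = K + W - W := (add_sub_cancel_right K W).symm
    rw [hKX] at hsym hreg ⊢
    exact rank_feedback_of_isRegularIndexLEOne hE hEC hCS hES hsym hreg
  · rintro ⟨k, hkr, hk, hskew⟩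
    obtain ⟨K, hpsd, hrank, hreg⟩ := exists_feedback_of_le_rank hE hEC hA hCS hES hk hskew
    rw [← transpose_mul_feedback hB] at hpsd hrank hreg
    rw [rank_transpose_mul_of_isUnit hQ] at hrank
    exact ⟨K, (isRegularIndexLEOne_mul_iff hQt).1 hreg, by omega,
      isPortHamiltonian_of_transpose_mul hQ hB hpsd hA⟩

theorem proportional_derivative_feedback_iff
    (hQ : IsUnit Q) (hB : Qᵀ * B = Cᵀ) (hE : (Qᵀ * E).PosSemidef)
    (hA : ∀ v, v ⬝ᵥ (Qᵀ * A) *ᵥ v ≤ 0) (hEC : ∀ v, (Qᵀ * E) *ᵥ v = 0 → C *ᵥ v = 0 → v = 0)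
    (r : ℕ) :
    (∃ F K : Matrix (Fin m) (Fin m) ℝ,
        IsRegularIndexLEOne (E + B * K * C) (A + B * F * C) ∧ (E + B * K * C).rank = r ∧
        IsPortHamiltonian (E + B * K * C) (A + B * F * C) B C) ↔
      n ≤ r + B.rank ∧ r ≤ n := by
  have hQt : IsUnit Qᵀ := (Matrix.isUnit_transpose _).2 hQ
  have hBC : B.rank = C.rank := by
    rw [← rank_transpose_mul_of_isUnit hQ, hB, Matrix.rank_transpose]
  rw [hBC]
  constructor
  · rintro ⟨F, K, -, rfl, -⟩
    refine ⟨?_, (Matrix.rank_le_width _)⟩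
    rw [← rank_transpose_mul_of_isUnit hQ, transpose_mul_feedback hB]
    exact le_rank_feedback_add_rank hEC _
  · rintro ⟨h1, h2⟩
    obtain ⟨K, hpsd, hrank, hreg⟩ := exists_damped_feedback hE hEC hA (k := n - r) (by omega)
    have hF : Qᵀ * (A + B * (-1 : Matrix (Fin m) (Fin m) ℝ) * C) = Qᵀ * A - Cᵀ * C := by
      rw [transpose_mul_feedback hB]; simp [sub_eq_add_neg]
    rw [← transpose_mul_feedback hB] at hpsd hrank hreg
    rw [← hF] at hreg
    rw [rank_transpose_mul_of_isUnit hQ] at hrank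
    refine ⟨-1, K, (isRegularIndexLEOne_mul_iff hQt).1 hreg, by omega,
      isPortHamiltonian_of_transpose_mul hQ hB hpsd fun v => ?_⟩
    rw [hF, sub_mulVec, dotProduct_sub, ← mulVec_mulVec v Cᵀ, dotProduct_transpose_mulVec_comm]
    have h3 : 0 ≤ (C *ᵥ v) ⬝ᵥ (C *ᵥ v) := Finset.sum_nonneg fun i _ => mul_self_nonneg _
    linarith [hA v]

theorem exists_isNullPair {S : Matrix (Fin n) (Fin m) ℝ} {W : Matrix (Fin m) (Fin m) ℝ}
    (hQ : IsUnit Q) (hB : Qᵀ * B = Cᵀ) (hE : (Qᵀ * E).PosSemidef)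
    (hEC : ∀ v, (Qᵀ * E) *ᵥ v = 0 → C *ᵥ v = 0 → v = 0)
    (hCS : C * S = 1) (hES : Qᵀ * E * S = Cᵀ * W) : IsNullPair E B C (Q * S) S := by
  have hsymE : Eᵀ * Q = Qᵀ * E := by simpa using hE.1.eq
  have hQinj := Matrix.mulVec_injective_iff_isUnit.2 hQ
  have hQtinj := Matrix.mulVec_injective_iff_isUnit.2 ((Matrix.isUnit_transpose _).2 hQ)
  have hS : ∀ x, S *ᵥ x = 0 → x = 0 := fun x hx => by
    rw [← one_mulVec x, ← hCS, ← mulVec_mulVec, hx, mulVec_zero]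
  have hSmem : ∀ v, (∃ x, S *ᵥ x = v) ↔ ∃ y, Cᵀ *ᵥ y = (Qᵀ * E) *ᵥ v := fun v => by
    constructor
    · rintro ⟨x, rfl⟩
      exact ⟨W *ᵥ x, by rw [mulVec_mulVec, mulVec_mulVec, hES]⟩
    · rintro ⟨y, hy⟩
      exact ⟨_, mulVec_section_eq hE hEC hCS hES hy.symm⟩
  refine isNullPair_iff.2 ⟨⟨fun x hx => hS x (hQinj ?_), fun v => ?_⟩, hS, fun v => ?_⟩
  · rw [mulVec_mulVec, hx, mulVec_zero]
  · have hd := (Matrix.isUnit_iff_isUnit_det _).1 hQ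
    obtain ⟨u, rfl⟩ : ∃ u, Q *ᵥ u = v :=
      ⟨Q⁻¹ *ᵥ v, by rw [mulVec_mulVec, mul_nonsing_inv _ hd, one_mulVec]⟩
    simp_rw [← mulVec_mulVec, hQinj.eq_iff]
    rw [mulVec_mulVec, hsymE]
    exact hSmem u
  · rw [hSmem v, ← hB]
    simp_rw [← mulVec_mulVec, hQtinj.eq_iff]

/-- Write `T = Q P`. Both `P` and `S` become the unique section `S₀` after normalization, and `Tᵀ B
= (C P)ᵀ`, so the normalized matrix does not depend on the choices. -/
theorem IsNullPair.eq_normalized {T S S₀ : Matrix (Fin n) (Fin m) ℝ}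
    {W₀ : Matrix (Fin m) (Fin m) ℝ} (h : IsNullPair E B C T S)
    (hQ : IsUnit Q) (hB : Qᵀ * B = Cᵀ) (hE : (Qᵀ * E).PosSemidef)
    (hEC : ∀ v, (Qᵀ * E) *ᵥ v = 0 → C *ᵥ v = 0 → v = 0)
    (hCS : C * S₀ = 1) (hES : Qᵀ * E * S₀ = Cᵀ * W₀) :
    IsUnit (Tᵀ * B) ∧ IsUnit (C * S) ∧ (Tᵀ * A * S).rank = (S₀ᵀ * (Qᵀ * A) * S₀).rank ∧
      (Tᵀ * B)⁻¹ * (Tᵀ * A * S) * (C * S)⁻¹ = S₀ᵀ * (Qᵀ * A) * S₀ := by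
  have hsymE : Eᵀ * Q = Qᵀ * E := by simpa using hE.1.eq
  have hd := (Matrix.isUnit_iff_isUnit_det _).1 hQ
  obtain ⟨⟨hT, hTmem⟩, hS, hSmem⟩ := isNullPair_iff.1 h
  obtain ⟨W, hW⟩ := exists_eq_mul_of_forall (B := B) (M := E * S) fun x => by
    rw [← mulVec_mulVec]; exact (hSmem _).1 ⟨x, rfl⟩
  obtain ⟨V, hV⟩ := exists_eq_mul_of_forall (B := Cᵀ) (M := Eᵀ * T) fun x => by
    rw [← mulVec_mulVec]; exact (hTmem _).1 ⟨x, rfl⟩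
  obtain ⟨P, rfl⟩ : ∃ P, Q * P = T :=
    ⟨Q⁻¹ * T, by rw [← Matrix.mul_assoc, mul_nonsing_inv _ hd, Matrix.one_mul]⟩
  have hW' : Qᵀ * E * S = Cᵀ * W := by rw [Matrix.mul_assoc, hW, ← Matrix.mul_assoc, hB]
  have hV' : Qᵀ * E * P = Cᵀ * V := by rw [← hsymE, Matrix.mul_assoc, hV]
  have hP : ∀ x, P *ᵥ x = 0 → x = 0 := fun x hx =>
    hT x (by rw [← mulVec_mulVec, hx, mulVec_zero])
  have hSu := isUnit_mul_of_mul_eq hE hEC hS hW'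
  have hPu := isUnit_mul_of_mul_eq hE hEC hP hV'
  obtain ⟨hS1, _, hS2⟩ := exists_normalized_of_mul_eq hSu hW'
  obtain ⟨hP1, _, hP2⟩ := exists_normalized_of_mul_eq hPu hV'
  have hSd := (Matrix.isUnit_iff_isUnit_det _).1 hSu
  have hSS := section_unique hE hEC hCS hES hS1 hS2
  have hPS := section_unique hE hEC hCS hES hP1 hP2
  have hTB : (Q * P)ᵀ * B = (C * P)ᵀ := by
    rw [transpose_mul, Matrix.mul_assoc, hB, transpose_mul]
  have hTBu : IsUnit ((C * P)ᵀ) := (Matrix.isUnit_transpose _).2 hPu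
  have hform : ((C * P)ᵀ)⁻¹ * ((Q * P)ᵀ * A * S) * (C * S)⁻¹ = S₀ᵀ * (Qᵀ * A) * S₀ := by
    have h1 : S₀ᵀ * (Qᵀ * A) * S₀ = (P * (C * P)⁻¹)ᵀ * (Qᵀ * A) * (S * (C * S)⁻¹) := by
      rw [hSS, hPS]
    rw [h1, transpose_mul P, transpose_nonsing_inv, transpose_mul Q]
    simp only [Matrix.mul_assoc]
  rw [hTB]
  refine ⟨hTBu, hSu, ?_, hform⟩
  rw [← hform, rank_mul_eq_left_of_isUnit_det _ _ (isUnit_nonsing_inv_det _ hSd),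
    rank_mul_eq_right_of_isUnit_det _ _
      (isUnit_nonsing_inv_det _ ((Matrix.isUnit_iff_isUnit_det _).1 hTBu))]

end Main

theorem mainTheorem3 {n m : ℕ} (E A : Matrix (Fin n) (Fin n) ℝ)
    (B : Matrix (Fin n) (Fin m) ℝ) (C : Matrix (Fin m) (Fin n) ℝ)
    (hpH : IsPortHamiltonian E A B C) (hobs : IsCompletelyObservable E A C) (r : ℕ) :
    -- derivative feedback, for `C` of full row rank
    (C.rank = m →
      (∃ T S : Matrix (Fin n) (Fin m) ℝ, IsNullPair E B C T S) ∧
      ∀ T S : Matrix (Fin n) (Fin m) ℝ, IsNullPair E B C T S →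
        IsUnit (Tᵀ * B) ∧ IsUnit (C * S) ∧
        ((∃ K : Matrix (Fin m) (Fin m) ℝ,
            IsRegularIndexLEOne (E + B * K * C) A ∧
            (E + B * K * C).rank = r ∧
            IsPortHamiltonian (E + B * K * C) A B C) ↔
          ((n : ℤ) - ((Tᵀ * A * S).rank : ℤ) ≤ (r : ℤ) ∧ r ≤ n) ∧
          (0 < (Tᵀ * A * S).rank → Even (Tᵀ * A * S).rank →
            ((Tᵀ * B)⁻¹ * (Tᵀ * A * S) * (C * S)⁻¹)ᵀ =
              -((Tᵀ * B)⁻¹ * (Tᵀ * A * S) * (C * S)⁻¹) →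
            Even ((n : ℤ) - (r : ℤ))))) ∧
    -- proportional and derivative feedback
    ((∃ F K : Matrix (Fin m) (Fin m) ℝ,
        IsRegularIndexLEOne (E + B * K * C) (A + B * F * C) ∧
        (E + B * K * C).rank = r ∧
        IsPortHamiltonian (E + B * K * C) (A + B * F * C) B C) ↔
      (n : ℤ) - (B.rank : ℤ) ≤ (r : ℤ) ∧ r ≤ n) := by
  obtain ⟨Q, hQ, hB, hE, hA, hEC⟩ := hpH.exists_isUnit hobs
  refine ⟨fun hC => ?_, ?_⟩
  · obtain ⟨S₀, W₀, hCS, hES⟩ := exists_section hE hEC hC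
    -- All choices are bases of the same two subspaces, so one pair with `m` columns fixes the
    -- column count.
    refine ⟨⟨_, _, exists_isNullPair hQ hB hE hEC hCS hES⟩, fun T S hTS => ?_⟩
    obtain ⟨h1, h2, h3, h4⟩ := hTS.eq_normalized (A := A) hQ hB hE hEC hCS hES
    refine ⟨h1, h2, ?_⟩
    rw [derivative_feedback_iff hQ hB hE hA hEC hCS hES, h3, h4]
    constructor
    · rintro ⟨k, rfl, hk, hskew⟩
      refine ⟨⟨by push_cast; omega, by omega⟩, fun _ _ h => ?_⟩
      rw [show ((k + r : ℕ) : ℤ) - r = k by push_cast; ring]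
      exact (Int.even_coe_nat k).2 (hskew h)
    · rintro ⟨⟨h5, h6⟩, h7⟩
      refine ⟨n - r, by omega, by omega, fun h => ?_⟩
      -- Rank zero forces `r = n`; otherwise a skew matrix has even rank, so the parity clause
      -- applies.
      rcases Nat.eq_zero_or_pos (S₀ᵀ * (Qᵀ * A) * S₀).rank with h0 | hpos
      · rw [show n - r = 0 by omega]
        exact Even.zero
      · rw [← Int.even_coe_nat, Nat.cast_sub h6]
        exact h7 hpos (even_rank_of_transpose_eq_neg h) h
  · rw [proportional_derivative_feedback_iff hQ hB hE hA hEC]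
    omega
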